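/- There are absolute constants $c > 0$ and $C > 0$ with the following property. Let $X \geq 9$ be an integer, let $\delta > 0$, and let $\mathcal{A}$ be a set of integers. Suppose that for every odd prime $p \leq X^{1/2}$ there is a set $S_p \subset \mathbb{Z}/p\mathbb{Z}$ of size exactly $(p+1)/2$ which contains at least $(\frac{1}{16}+\delta)p^3$ additive quadruples, that is to say quadruples $(s_1,s_2,s_3,s_4) \in S_p^4$ with $s_1+s_2=s_3+s_4$, and such that $\mathcal{A} \bmod p \subset S_p$. Then $$|\mathcal{A} \cap \{1,\dots,X\}| \leq C X^{1/2 - c\delta^2}.$$ -/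

import Mathlib

/-- `𝒜[X] = 𝒜 ∩ {1, …, X}`, the part of a set of integers in the initial segment `[X]`. -/
def initialPart (A : Set ℤ) (X : ℕ) : Set ℤ :=
  A ∩ Set.Icc 1 (X : ℤ)

/-! Let `B = 𝒜[X]` and `N = |B|`. Suppose `N ≥ X^(1/2 - cδ)`, with `c` small and `δ log X` large.
Two incompatible estimates follow for the additive energy `E = ∑ diffCount B n ^ 2`, whose trivial
upper bound is `N³`.

Both rest on Gallagher's larger sieve. Counting pairs of `B` congruent mod `p`, weighted by `log p`,
gives at most about `N² log X`. Cauchy–Schwarz gives at least `N²/|S_p| ≈ 2N²/p` pairs for each `p`,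
and Mertens' theorem shows that the primes up to nearly `√X` already use up nearly all of `N² log
X`. So a near-extremal `B` is almost uniform on `S_p` for most `p`.

Lower bound (`exists_sum_sq_diffCount_ge`): the excess of additive quadruples gives `S_p` a large
nontrivial Fourier coefficient, and near-uniformity passes it on to `B` at some fraction `r/p`.
These fractions are `1/X`-separated, so a dual large sieve turns about `X^(1/2)` large exponential
sums into `E ≥ N³ X^(-ε)`.

Upper bound (`exists_sum_sq_diffCount_lt`): if `E ≥ N³ X^(-ε)`, there are nearly `√X` popular
differences `d`. Each `B ∩ (B + d)` is large and lies in `S_p ∩ (S_p + d)`, so by the larger sieve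
`d` almost fixes `S_p` for most `p`. Cauchy–Davenport allows `S_p` at most `p/7` such shifts
(`card_almostPeriods_le`). The set of popular differences thus lies, up to few exceptions, in `p/7`
classes for most `p`, and has far too many collisions for the larger sieve.

When `δ log X` is bounded, the bound `N ≪ √X` suffices (`exists_card_le_mul_sqrt`), and small `X`
are absorbed into `C`. -/

/-! ### Chebyshev and Mertens estimates for primes. -/

open Finset in
/-- The primes not exceeding `y`. -/
noncomputable def primesUpTo (y : ℝ) : Finset ℕ := (Icc 0 ⌊y⌋₊).filter Nat.Prime

theorem mem_primesUpTo {y : ℝ} (hy : 0 ≤ y) {p : ℕ} :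
    p ∈ primesUpTo y ↔ p.Prime ∧ (p : ℝ) ≤ y := by
  simp [primesUpTo, Nat.le_floor_iff hy, and_comm]

theorem primesUpTo_prime {y : ℝ} {p : ℕ} (h : p ∈ primesUpTo y) : p.Prime := by
  simp [primesUpTo] at h; exact h.2

theorem sum_log_primesUpTo_le {y : ℝ} (hy : 0 ≤ y) :
    ∑ p ∈ primesUpTo y, Real.log p ≤ Real.log 4 * y := by
  have h := Chebyshev.theta_le_log4_mul_x hy
  rwa [Chebyshev.theta_eq_sum_Icc] at h

/-- Since `log p ≤ 2 p^(1/2)`, the terms are dominated by the convergent series of `4 n^(-3/2)`.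
This makes the replacement of `1/p` by `1/(p ± 1)` harmless throughout. -/
theorem exists_sum_log_div_mul_le :
    ∃ K : ℝ, 0 < K ∧ ∀ P : Finset ℕ, (∀ p ∈ P, p.Prime) →
      ∑ p ∈ P, Real.log p / ((p : ℝ) * (p - 1)) ≤ K := by
  have hs : Summable fun n : ℕ => 4 * (1 / (n : ℝ) ^ (3 / 2 : ℝ)) :=
    (Real.summable_one_div_nat_rpow.2 (by norm_num)).mul_left 4
  refine ⟨(∑' n : ℕ, 4 * (1 / (n : ℝ) ^ (3 / 2 : ℝ))) + 1, ?_, fun P hP => ?_⟩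
  · have : 0 ≤ ∑' n : ℕ, 4 * (1 / (n : ℝ) ^ (3 / 2 : ℝ)) := tsum_nonneg fun n => by positivity
    linarith
  · have h1 : ∑ p ∈ P, Real.log p / ((p : ℝ) * (p - 1)) ≤
        ∑ p ∈ P, 4 * (1 / (p : ℝ) ^ (3 / 2 : ℝ)) := by
      refine Finset.sum_le_sum fun p hp => ?_
      have h2 : (2 : ℝ) ≤ p := by exact_mod_cast (hP p hp).two_le
      have hl : Real.log p ≤ (p : ℝ) ^ (1 / 2 : ℝ) / (1 / 2) :=
        Real.log_le_rpow_div (by positivity) (by norm_num)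
      have hm : (p : ℝ) ^ (1 / 2 : ℝ) * (p : ℝ) ^ (3 / 2 : ℝ) = (p : ℝ) ^ 2 := by
        rw [← Real.rpow_add (by positivity)]; norm_num
      have h0 : 0 < (p : ℝ) ^ (3 / 2 : ℝ) := by positivity
      rw [mul_one_div, div_le_div_iff₀ (by nlinarith) h0]
      calc Real.log p * (p : ℝ) ^ (3 / 2 : ℝ)
          ≤ ((p : ℝ) ^ (1 / 2 : ℝ) / (1 / 2)) * (p : ℝ) ^ (3 / 2 : ℝ) := by gcongr
        _ = 2 * (p : ℝ) ^ 2 := by rw [← hm]; ring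
        _ ≤ 4 * (p * (p - 1)) := by nlinarith
    have h2 := hs.sum_le_tsum P (fun n _ => by positivity)
    linarith

theorem log_factorial_eq_sum (n : ℕ) :
    Real.log (n.factorial) =
      ∑ p ∈ primesUpTo n, (n.factorial.factorization p : ℝ) * Real.log p := by
  rw [Real.log_nat_eq_sum_factorization, Finsupp.sum]
  refine Finset.sum_subset ?_ ?_
  · intro p hp
    rw [Nat.support_factorization, Nat.mem_primeFactors] at hp
    rw [mem_primesUpTo (by positivity)]
    exact ⟨hp.1, by exact_mod_cast (hp.1.dvd_factorial.1 hp.2.1)⟩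
  · intro p _ hp
    rw [Finsupp.notMem_support_iff] at hp
    simp [hp]

/-- Legendre's formula gives `v_p(n!) ≥ ⌊n/p⌋ > n/p - 1`; compare with `log n! ≤ n log n`. The lost
`1` costs `θ(n) ≤ n log 4`. -/
theorem sum_log_div_le_of_nat {n : ℕ} (hn : 1 ≤ n) :
    ∑ p ∈ primesUpTo n, Real.log p / p ≤ Real.log n + Real.log 4 := by
  have hn' : (0 : ℝ) < n := by exact_mod_cast hn
  have h1 : ∑ p ∈ primesUpTo n, ((n : ℝ) / p - 1) * Real.log p ≤ Real.log (n.factorial) := by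
    rw [log_factorial_eq_sum]
    refine Finset.sum_le_sum fun p hp => ?_
    have hpp := primesUpTo_prime hp
    have hl : 0 ≤ Real.log p := Real.log_natCast_nonneg p
    refine mul_le_mul_of_nonneg_right ?_ hl
    have h2 : n / p ≤ n.factorial.factorization p := by
      rw [← hpp.pow_dvd_iff_le_factorization (Nat.factorial_ne_zero n),
        hpp.pow_dvd_factorial_iff (lt_add_one (Nat.log p n))]
      by_cases h : 1 < Nat.log p n + 1
      · calc n / p = n / p ^ 1 := by simp
          _ ≤ _ := Finset.single_le_sum (f := fun i => n / p ^ i) (fun _ _ => Nat.zero_le _)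
            (Finset.mem_Ico.2 ⟨le_rfl, h⟩)
      · have : n < p := by
          by_contra! h3
          have := Nat.log_pos hpp.one_lt h3
          omega
        simp [Nat.div_eq_of_lt this]
    have h3 : (n : ℝ) / p < ((n / p : ℕ) : ℝ) + 1 := by
      have h5 := Nat.lt_floor_add_one ((n : ℝ) / p)
      rwa [Nat.floor_div_eq_div] at h5
    have h4 : ((n / p : ℕ) : ℝ) ≤ n.factorial.factorization p := by exact_mod_cast h2
    linarith
  have h2 : Real.log (n.factorial) ≤ n * Real.log n := by
    have : (n.factorial : ℝ) ≤ (n : ℝ) ^ n := by exact_mod_cast Nat.factorial_le_pow n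
    calc Real.log (n.factorial) ≤ Real.log ((n : ℝ) ^ n) :=
          Real.log_le_log (by exact_mod_cast Nat.factorial_pos n) this
      _ = n * Real.log n := by rw [Real.log_pow]
  have h3 := sum_log_primesUpTo_le hn'.le
  have h4 : ∑ p ∈ primesUpTo n, ((n : ℝ) / p - 1) * Real.log p =
      n * ∑ p ∈ primesUpTo n, Real.log p / p - ∑ p ∈ primesUpTo n, Real.log p := by
    rw [Finset.mul_sum, ← Finset.sum_sub_distrib]
    refine Finset.sum_congr rfl fun p _ => by ring
  have : n * ∑ p ∈ primesUpTo n, Real.log p / p ≤ n * (Real.log n + Real.log 4) := by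
    nlinarith
  exact le_of_mul_le_mul_left this hn'

/-- Legendre from the other side: `v_p(n!) ≤ n/(p - 1)`, against `n! ≥ (n/e)^n`. The excess `1/(p -
1) - 1/p` is summed by `K`. -/
theorem log_le_sum_log_div_of_nat {K : ℝ}
    (hK : ∀ P : Finset ℕ, (∀ p ∈ P, p.Prime) →
      ∑ p ∈ P, Real.log p / ((p : ℝ) * (p - 1)) ≤ K) {n : ℕ} (hn : 1 ≤ n) :
    Real.log n - 1 - K ≤ ∑ p ∈ primesUpTo n, Real.log p / p := by
  have hn' : (0 : ℝ) < n := by exact_mod_cast hn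
  have h1 : Real.log (n.factorial) ≤ ∑ p ∈ primesUpTo n, ((n : ℝ) / (p - 1)) * Real.log p := by
    rw [log_factorial_eq_sum]
    refine Finset.sum_le_sum fun p hp => ?_
    have hpp := primesUpTo_prime hp
    have h2 : (2 : ℝ) ≤ p := by exact_mod_cast hpp.two_le
    refine mul_le_mul_of_nonneg_right ?_ (Real.log_natCast_nonneg p)
    have h3 : n.factorial.factorization p ≤ n / (p - 1) :=
      Nat.factorization_factorial_le_div_pred hpp n
    calc (n.factorial.factorization p : ℝ) ≤ ((n / (p - 1) : ℕ) : ℝ) := by exact_mod_cast h3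
      _ ≤ (n : ℝ) / ((p - 1 : ℕ) : ℝ) := Nat.cast_div_le
      _ = _ := by rw [Nat.cast_sub hpp.one_le]; simp
  have h2 : n * Real.log n - n ≤ Real.log (n.factorial) := by
    have h5 := Real.exp_pos (n : ℝ)
    have : ((n : ℝ) ^ n) / n.factorial ≤ Real.exp n := Real.pow_div_factorial_le_exp (n : ℝ) hn'.le n
    have hf : (0 : ℝ) < n.factorial := by exact_mod_cast Nat.factorial_pos n
    rw [div_le_iff₀ hf] at this
    have h6 := Real.log_le_log (by positivity) this
    rw [Real.log_pow, Real.log_mul h5.ne' hf.ne', Real.log_exp] at h6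
    linarith
  have h4 : ∑ p ∈ primesUpTo n, ((n : ℝ) / (p - 1)) * Real.log p =
      n * (∑ p ∈ primesUpTo n, Real.log p / p +
        ∑ p ∈ primesUpTo n, Real.log p / ((p : ℝ) * (p - 1))) := by
    rw [← Finset.sum_add_distrib, Finset.mul_sum]
    refine Finset.sum_congr rfl fun p hp => ?_
    have h2 : (2 : ℝ) ≤ p := by exact_mod_cast (primesUpTo_prime hp).two_le
    have : (p : ℝ) - 1 ≠ 0 := by linarith
    field_simp
    ring
  have h5 := hK (primesUpTo n) fun p hp => primesUpTo_prime hp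
  have h6 : n * (Real.log n - 1) ≤ n * (∑ p ∈ primesUpTo n, Real.log p / p +
        ∑ p ∈ primesUpTo n, Real.log p / ((p : ℝ) * (p - 1))) := by
    rw [← h4]; linarith
  have := le_of_mul_le_mul_left h6 hn'
  linarith

/-- Mertens' first theorem, with an unspecified constant. -/
theorem exists_abs_sum_log_div_sub_log_le :
    ∃ M : ℝ, 0 < M ∧ ∀ y : ℝ, 1 ≤ y →
      |∑ p ∈ primesUpTo y, Real.log p / p - Real.log y| ≤ M := by
  obtain ⟨K, hK0, hK⟩ := exists_sum_log_div_mul_le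
  refine ⟨2 + K + Real.log 4, by positivity, fun y hy => ?_⟩
  have hn : 1 ≤ ⌊y⌋₊ := (Nat.one_le_floor_iff y).2 hy
  have hn' : (1 : ℝ) ≤ (⌊y⌋₊ : ℝ) := by exact_mod_cast hn
  have he : primesUpTo y = primesUpTo (⌊y⌋₊ : ℝ) := by simp [primesUpTo]
  have h1 := sum_log_div_le_of_nat hn
  have h2 := log_le_sum_log_div_of_nat hK hn
  rw [← he] at h1 h2
  have h3 : Real.log ⌊y⌋₊ ≤ Real.log y := Real.log_le_log (by linarith) (Nat.floor_le (by linarith))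
  have h4 : Real.log y ≤ Real.log ⌊y⌋₊ + 1 := by
    have h5 : y ≤ 2 * ⌊y⌋₊ := by linarith [Nat.lt_floor_add_one y]
    calc Real.log y ≤ Real.log (2 * ⌊y⌋₊) := Real.log_le_log (by linarith) h5
      _ = Real.log 2 + Real.log ⌊y⌋₊ := Real.log_mul (by norm_num) (by linarith)
      _ ≤ _ := by linarith [Real.log_two_lt_d9]
  have h6 : 0 ≤ Real.log 4 := Real.log_nonneg (by norm_num)
  rw [abs_le]
  constructor <;> linarith

/-! ### Collisions mod `p` and Gallagher's larger sieve. -/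

/-- The number of ordered pairs of elements of `B` that are congruent mod `p`. -/
def collisions (B : Finset ℤ) (p : ℕ) : ℕ :=
  ((B ×ˢ B).filter fun b : ℤ × ℤ => (p : ℤ) ∣ b.1 - b.2).card

/-- The number of elements of `B` in the residue class `x` mod `p`. -/
def classCount (B : Finset ℤ) (p : ℕ) (x : ZMod p) : ℕ :=
  (B.filter fun b : ℤ => (b : ZMod p) = x).card

theorem collisions_eq_sum_sq (B : Finset ℤ) (p : ℕ) [NeZero p] :
    collisions B p = ∑ x : ZMod p, classCount B p x ^ 2 := by
  classical
  have h : ∀ x : ZMod p, classCount B p x ^ 2 =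
      ((B ×ˢ B).filter fun b : ℤ × ℤ => (b.1 : ZMod p) = x ∧ (b.2 : ZMod p) = x).card := by
    intro x
    rw [classCount, sq, ← Finset.card_product]
    congr 1
    ext b
    simp only [Finset.mem_product, Finset.mem_filter]
    tauto
  simp_rw [h]
  rw [collisions, Finset.card_eq_sum_card_fiberwise (f := fun b : ℤ × ℤ => (b.1 : ZMod p))
    (t := Finset.univ) (fun _ _ => Finset.mem_coe.2 (Finset.mem_univ _))]
  refine Finset.sum_congr rfl fun x _ => ?_
  rw [Finset.filter_filter]
  congr 1
  refine Finset.filter_congr fun b _ => ?_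
  have : (p : ℤ) ∣ b.1 - b.2 ↔ (b.1 : ZMod p) = b.2 := by
    rw [← ZMod.intCast_zmod_eq_zero_iff_dvd, Int.cast_sub, sub_eq_zero] 
  rw [this]
  constructor
  · rintro ⟨h1, h2⟩; exact ⟨h2, h1 ▸ h2⟩
  · rintro ⟨h1, h2⟩; exact ⟨h1.trans h2.symm, h1⟩

theorem sum_classCount (B : Finset ℤ) (p : ℕ) (T : Finset (ZMod p)) :
    ∑ x ∈ T, classCount B p x = (B.filter fun b : ℤ => (b : ZMod p) ∈ T).card := by
  classical
  have hm : ∀ b ∈ B.filter (fun b : ℤ => (b : ZMod p) ∈ T), (b : ZMod p) ∈ T :=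
    fun b hb => (Finset.mem_filter.1 hb).2
  rw [Finset.card_eq_sum_card_fiberwise hm]
  refine Finset.sum_congr rfl fun x hx => ?_
  rw [Finset.filter_filter, classCount]
  congr 1
  refine Finset.filter_congr fun b _ => ?_
  constructor
  · rintro rfl; exact ⟨hx, rfl⟩
  · exact fun h => h.2

/-- Cauchy–Schwarz over the classes in `T`. The filter is kept because the set of popular
differences falls only mostly, not entirely, into the classes of interest. -/
theorem sq_card_filter_le_card_mul_collisions (B : Finset ℤ) (p : ℕ) [NeZero p]
    (T : Finset (ZMod p)) :
    ((B.filter fun b : ℤ => (b : ZMod p) ∈ T).card : ℝ) ^ 2 ≤ T.card * (collisions B p : ℝ) := by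
  rw [← sum_classCount, collisions_eq_sum_sq]
  push_cast
  calc (∑ x ∈ T, (classCount B p x : ℝ)) ^ 2
      ≤ T.card * ∑ x ∈ T, (classCount B p x : ℝ) ^ 2 := sq_sum_le_card_mul_sum_sq
    _ ≤ T.card * ∑ x : ZMod p, (classCount B p x : ℝ) ^ 2 := by
      gcongr
      exact Finset.subset_univ T

theorem sq_card_le_card_mul_collisions {B : Finset ℤ} {p : ℕ} [NeZero p]
    {T : Finset (ZMod p)} (h : ∀ b ∈ B, (b : ZMod p) ∈ T) :
    (B.card : ℝ) ^ 2 ≤ T.card * (collisions B p : ℝ) := by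
  have := sq_card_filter_le_card_mul_collisions B p T
  rwa [Finset.filter_true_of_mem h] at this

theorem sq_card_le_mul_collisions (B : Finset ℤ) (p : ℕ) [NeZero p] :
    (B.card : ℝ) ^ 2 ≤ p * (collisions B p : ℝ) := by
  have := sq_card_le_card_mul_collisions (B := B) (p := p) (T := Finset.univ)
    fun _ _ => Finset.mem_univ _
  simpa [ZMod.card] using this

/-- A product of distinct primes dividing `n` divides `n`. -/
theorem sum_log_dvd_le {P : Finset ℕ} (hP : ∀ p ∈ P, p.Prime) {n : ℤ} (hn : n ≠ 0) :
    ∑ p ∈ P.filter (fun p : ℕ => (p : ℤ) ∣ n), Real.log p ≤ Real.log |(n : ℝ)| := by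
  have hd : ∏ p ∈ P.filter (fun p : ℕ => (p : ℤ) ∣ n), p ∣ n.natAbs := by
    refine Finset.prod_primes_dvd _ (fun p hp => (hP p (Finset.mem_filter.1 hp).1).prime)
      fun p hp => Int.natCast_dvd.1 (Finset.mem_filter.1 hp).2
  have h1 := Nat.le_of_dvd (Int.natAbs_pos.2 hn) hd
  rw [← Real.log_prod fun p hp => by
    exact_mod_cast (hP p (Finset.mem_filter.1 hp).1).ne_zero]
  have h2 : (0 : ℝ) < ∏ p ∈ P.filter (fun p : ℕ => (p : ℤ) ∣ n), (p : ℝ) :=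
    Finset.prod_pos fun p hp => by exact_mod_cast (hP p (Finset.mem_filter.1 hp).1).pos
  refine Real.log_le_log h2 ?_
  have h3 : ((∏ p ∈ P.filter (fun p : ℕ => (p : ℤ) ∣ n), p : ℕ) : ℝ) ≤ (n.natAbs : ℝ) := by
    exact_mod_cast h1
  rw [Nat.cast_natAbs, Int.cast_abs] at h3
  simpa using h3

/-- Gallagher's larger sieve, in the form of an upper bound for collisions. -/
theorem sum_log_mul_collisions_le {B : Finset ℤ} {Y : ℝ} (hY : 1 ≤ Y)
    (hB : ∀ b ∈ B, ∀ b' ∈ B, |(b : ℝ) - b'| ≤ Y) {P : Finset ℕ} (hP : ∀ p ∈ P, p.Prime) :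
    ∑ p ∈ P, Real.log p * collisions B p ≤
      (B.card : ℝ) ^ 2 * Real.log Y + B.card * ∑ p ∈ P, Real.log p := by
  classical
  have hlY := Real.log_nonneg hY
  have hS : 0 ≤ ∑ p ∈ P, Real.log p := Finset.sum_nonneg fun p _ => Real.log_natCast_nonneg p
  have h1 : ∑ p ∈ P, Real.log p * collisions B p =
      ∑ b ∈ B ×ˢ B, ∑ p ∈ P.filter (fun p : ℕ => (p : ℤ) ∣ b.1 - b.2), Real.log p := by
    simp_rw [Finset.sum_filter]
    rw [Finset.sum_comm]
    refine Finset.sum_congr rfl fun p _ => ?_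
    rw [← Finset.sum_filter, Finset.sum_const, collisions, nsmul_eq_mul, mul_comm]
  -- A diagonal pair collides modulo every prime; any other pair only modulo the prime divisors of a
  -- nonzero integer of size at most `Y`.
  have h2 : ∀ b ∈ B ×ˢ B, ∑ p ∈ P.filter (fun p : ℕ => (p : ℤ) ∣ b.1 - b.2), Real.log p ≤
      Real.log Y + if b.1 = b.2 then ∑ p ∈ P, Real.log p else 0 := by
    rintro ⟨b, b'⟩ hb
    rw [Finset.mem_product] at hb
    split_ifs with h
    · simp only at h
      simp [h, hlY]
    · simp only at h
      have h3 : b - b' ≠ 0 := sub_ne_zero.2 h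
      refine (sum_log_dvd_le hP h3).trans ?_
      rw [add_zero]
      have h4 := hB b hb.1 b' hb.2
      refine Real.log_le_log ?_ (by push_cast; exact h4)
      exact abs_pos.2 (by exact_mod_cast h3)
  rw [h1]
  refine (Finset.sum_le_sum h2).trans (le_of_eq ?_)
  rw [Finset.sum_add_distrib, Finset.sum_const, Finset.card_product, Finset.sum_product]
  simp only [Finset.sum_ite_eq, nsmul_eq_mul]
  rw [Finset.sum_congr rfl fun b hb => if_pos hb, Finset.sum_const, nsmul_eq_mul]
  push_cast
  ring

/-! ### Exponential sums, a dual large sieve and additive energy. -/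

/-- `e(x) = exp(2πix)`. -/
noncomputable def addExp (x : ℝ) : ℂ := Complex.exp (Complex.I * ((2 * Real.pi * x : ℝ) : ℂ))

theorem addExp_add (x y : ℝ) : addExp (x + y) = addExp x * addExp y := by
  rw [addExp, addExp, addExp, ← Complex.exp_add]
  congr 1
  push_cast
  ring

theorem norm_addExp (x : ℝ) : ‖addExp x‖ = 1 := by
  rw [addExp, mul_comm, Complex.norm_exp_ofReal_mul_I]

theorem addExp_intCast (m : ℤ) : addExp m = 1 := by
  rw [addExp, Complex.exp_eq_one_iff]
  exact ⟨m, by push_cast; ring⟩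

theorem star_addExp (x : ℝ) : (starRingEnd ℂ) (addExp x) = addExp (-x) := by
  rw [addExp, addExp, ← Complex.exp_conj, map_mul, Complex.conj_I, Complex.conj_ofReal]
  congr 1
  push_cast
  ring

theorem addExp_nat_mul (n : ℕ) (x : ℝ) : addExp (n * x) = addExp x ^ n := by
  rw [addExp, addExp, ← Complex.exp_nat_mul]
  congr 1
  push_cast
  ring

theorem four_mul_abs_le_norm_addExp_sub_one {b : ℝ} (hb : |b| ≤ 1 / 2) :
    4 * |b| ≤ ‖addExp b - 1‖ := by
  have h1 : |Real.pi * b| ≤ Real.pi / 2 := by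
    rw [abs_mul, abs_of_pos Real.pi_pos]
    nlinarith [Real.pi_pos]
  have h2 := Real.mul_abs_le_abs_sin h1
  rw [addExp, Complex.norm_exp_I_mul_ofReal_sub_one, norm_mul, Real.norm_eq_abs, Real.norm_eq_abs,
    show 2 * Real.pi * b / 2 = Real.pi * b by ring, abs_of_pos (by norm_num : (0 : ℝ) < 2)]
  rw [abs_mul, abs_of_pos Real.pi_pos] at h2
  have h3 : 2 / Real.pi * (Real.pi * |b|) = 2 * |b| := by field_simp
  linarith

theorem sum_Icc_neg_eq_sum_range {M : Type*} [AddCommMonoid M] (X : ℕ) (F : ℤ → M) :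
    ∑ n ∈ Finset.Icc (-(X : ℤ)) X, F n = ∑ k ∈ Finset.range (2 * X + 1), F ((k : ℤ) - X) := by
  refine Finset.sum_nbij' (fun n => (n + X).toNat) (fun k => (k : ℤ) - X) ?_ ?_ ?_ ?_ ?_
  · intro n hn
    simp only [Finset.mem_Icc, Finset.mem_range] at *
    omega
  · intro n hn
    simp only [Finset.mem_Icc, Finset.mem_range] at *
    omega
  · intro n hn
    simp only [Finset.mem_Icc] at *
    omega
  · intro n hn
    simp
  · intro n hn
    simp only [Finset.mem_Icc] at *
    congr 1
    omega

/-- Geometric series: the numerator is at most `2` and the denominator `|e(b) - 1|` at least `4|b|`.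
Integer shifts of the frequency do not matter. -/
theorem norm_sum_addExp_le {X : ℕ} {b β : ℝ} {m : ℤ} (hβ : β = b + m) (hb : |b| ≤ 1 / 2)
    (hb0 : b ≠ 0) :
    ‖∑ n ∈ Finset.Icc (-(X : ℤ)) X, addExp (n * β)‖ ≤ 1 / (2 * |b|) := by
  have h1 : ∑ n ∈ Finset.Icc (-(X : ℤ)) X, addExp (n * β) =
      addExp (-(X : ℝ) * b) * ∑ k ∈ Finset.range (2 * X + 1), addExp b ^ k := by
    rw [sum_Icc_neg_eq_sum_range, Finset.mul_sum]
    refine Finset.sum_congr rfl fun k _ => ?_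
    rw [← addExp_nat_mul, ← addExp_add, hβ]
    have : (((k : ℤ) - (X : ℤ) : ℤ) : ℝ) * (b + m) =
        (-(X : ℝ) * b + k * b) + (((k : ℤ) - X) * m : ℤ) := by push_cast; ring
    rw [this, addExp_add _ (((k : ℤ) - X) * m : ℤ), addExp_intCast, mul_one]
  have h2 := four_mul_abs_le_norm_addExp_sub_one hb
  have h3 : 0 < |b| := abs_pos.2 hb0
  rw [h1, norm_mul, norm_addExp, one_mul, le_div_iff₀ (by positivity)]
  have h4 : ‖addExp b - 1‖ * ‖∑ k ∈ Finset.range (2 * X + 1), addExp b ^ k‖ ≤ 2 := by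
    rw [← norm_mul, mul_geom_sum]
    refine (norm_sub_le _ _).trans ?_
    rw [norm_pow, norm_addExp]
    norm_num
  have h5 : 0 ≤ ‖∑ k ∈ Finset.range (2 * X + 1), addExp b ^ k‖ := norm_nonneg _
  nlinarith

theorem sum_one_div_natAbs_le {ι : Type*} {J : Finset ι} {m : ι → ℤ} {X : ℕ}
    (hinj : ∀ i ∈ J, ∀ j ∈ J, (m i).natAbs = (m j).natAbs → i = j)
    (h0 : ∀ i ∈ J, m i ≠ 0) (hX : ∀ i ∈ J, (m i).natAbs ≤ X) :
    ∑ j ∈ J, (((m j).natAbs : ℝ))⁻¹ ≤ 1 + Real.log X := by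
  classical
  have h1 := harmonic_le_one_add_log X
  rw [harmonic_eq_sum_Icc] at h1
  push_cast at h1
  refine le_trans ?_ h1
  rw [← Finset.sum_image (s := J) (g := fun j => (m j).natAbs) (f := fun k : ℕ => (k : ℝ)⁻¹)
    (fun i hi j hj h => hinj i hi j hj h)]
  refine Finset.sum_le_sum_of_subset_of_nonneg ?_ fun _ _ _ => by positivity
  intro k hk
  obtain ⟨j, hj, rfl⟩ := Finset.mem_image.1 hk
  exact Finset.mem_Icc.2 ⟨Int.natAbs_pos.2 (h0 j hj), hX j hj⟩

/-- Rounding: the integers `⌊X b_j⌋` are distinct by separation and nonzero since `|b_j| ≥ 1/X`, and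
are at most `2X|b_j|` in size. The positive and the negative ones each contribute at most a harmonic
sum. -/
theorem sum_inv_le_of_separated {ι : Type*} {J : Finset ι} {b : ι → ℝ} {X : ℕ} (hX : 2 ≤ X)
    (hb : ∀ i ∈ J, |b i| ≤ 1 / 2) (hb0 : ∀ i ∈ J, 1 / (X : ℝ) ≤ |b i|)
    (hsep : ∀ i ∈ J, ∀ j ∈ J, i ≠ j → 1 / (X : ℝ) ≤ |b i - b j|) :
    ∑ j ∈ J, 1 / (2 * |b j|) ≤ 2 * X * (1 + Real.log X) := by
  classical
  have hX' : (2 : ℝ) ≤ X := by exact_mod_cast hX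
  have hX0 : (0 : ℝ) < X := by linarith
  set m : ι → ℤ := fun j => ⌊X * b j⌋ with hm
  have hle : ∀ j, (m j : ℝ) ≤ X * b j := fun j => Int.floor_le _
  have hlt : ∀ j, X * b j < m j + 1 := fun j => Int.lt_floor_add_one _
  have hge1 : ∀ j ∈ J, 1 ≤ X * |b j| := fun j hj => by
    have := hb0 j hj
    rwa [div_le_iff₀ hX0, mul_comm] at this
  have hm0 : ∀ j ∈ J, m j ≠ 0 := by
    intro j hj h
    have h1 := hle j
    have h2 := hlt j
    have h3 := hge1 j hj
    rw [h] at h1 h2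
    push_cast at h1 h2
    have h4 : 0 ≤ b j := by nlinarith
    rw [abs_of_nonneg h4] at h3
    linarith
  have habs : ∀ j ∈ J, |(m j : ℝ)| ≤ 2 * (X * |b j|) ∧ |(m j : ℝ)| ≤ X := by
    intro j hj
    have h1 := hle j
    have h2 := hlt j
    have h3 := hge1 j hj
    have h4 := hb j hj
    have h5 : |X * b j| = X * |b j| := by rw [abs_mul, abs_of_pos hX0]
    have h6 := abs_le.1 h5.le
    have h7 : X * |b j| ≤ X * (1 / 2) := by gcongr
    constructor <;> rw [abs_le] <;> constructor <;> linarith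
  have hminj : ∀ i ∈ J, ∀ j ∈ J, m i = m j → i = j := by
    intro i hi j hj h
    by_contra hne
    have h1 := hsep i hi j hj hne
    rw [div_le_iff₀ hX0] at h1
    have h2 : |b i - b j| * X < 1 := by
      rw [← abs_of_pos hX0, ← abs_mul, abs_lt]
      have e1 := hle i
      have e2 := hlt i
      have e3 := hle j
      have e4 := hlt j
      rw [h] at e1 e2
      constructor <;> linarith
    linarith
  have hterm : ∀ j ∈ J, 1 / (2 * |b j|) ≤ X * (((m j).natAbs : ℝ))⁻¹ := by
    intro j hj
    have h1 : (0 : ℝ) < (m j).natAbs := by exact_mod_cast Int.natAbs_pos.2 (hm0 j hj)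
    have h2 : ((m j).natAbs : ℝ) = |(m j : ℝ)| := by rw [Nat.cast_natAbs, Int.cast_abs]
    have h3 : 0 < |b j| := lt_of_lt_of_le (by positivity) (hb0 j hj)
    rw [← div_eq_mul_inv, div_le_div_iff₀ (by positivity) h1, h2]
    linarith [(habs j hj).1]
  have hnat : ∀ j ∈ J, (m j).natAbs ≤ X := by
    intro j hj
    have h2 : ((m j).natAbs : ℝ) = |(m j : ℝ)| := by rw [Nat.cast_natAbs, Int.cast_abs]
    have := (habs j hj).2
    rw [← h2] at this
    exact_mod_cast this
  have hpos := sum_one_div_natAbs_le (J := J.filter fun j => 0 < m j) (m := m) (X := X)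
    (fun i hi j hj h => by
      rw [Finset.mem_filter] at hi hj
      exact hminj i hi.1 j hj.1 (by omega))
    (fun i hi => hm0 i (Finset.mem_filter.1 hi).1) (fun i hi => hnat i (Finset.mem_filter.1 hi).1)
  have hneg := sum_one_div_natAbs_le (J := J.filter fun j => ¬ 0 < m j) (m := m) (X := X)
    (fun i hi j hj h => by
      rw [Finset.mem_filter] at hi hj
      exact hminj i hi.1 j hj.1 (by omega))
    (fun i hi => hm0 i (Finset.mem_filter.1 hi).1) (fun i hi => hnat i (Finset.mem_filter.1 hi).1)
  calc ∑ j ∈ J, 1 / (2 * |b j|) ≤ ∑ j ∈ J, X * (((m j).natAbs : ℝ))⁻¹ := Finset.sum_le_sum hterm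
    _ = X * (∑ j ∈ J.filter (fun j => 0 < m j), (((m j).natAbs : ℝ))⁻¹ +
          ∑ j ∈ J.filter (fun j => ¬ 0 < m j), (((m j).natAbs : ℝ))⁻¹) := by
        rw [Finset.sum_filter_add_sum_filter_not, Finset.mul_sum]
    _ ≤ X * ((1 + Real.log X) + (1 + Real.log X)) := by gcongr
    _ = _ := by ring

/-- A dual large sieve inequality, with a logarithmic loss. -/
theorem sum_sq_norm_sum_addExp_le {ι : Type*} {I : Finset ι} {α : ι → ℝ} {X : ℕ} (hX : 2 ≤ X)
    (hsep : ∀ i ∈ I, ∀ j ∈ I, i ≠ j → ∀ m : ℤ, 1 / (X : ℝ) ≤ |α i - α j - m|) :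
    ∑ n ∈ Finset.Icc (-(X : ℤ)) X, ‖∑ i ∈ I, addExp (n * α i)‖ ^ 2 ≤
      I.card * (2 * X + 1 + 2 * X * (1 + Real.log X)) := by
  classical
  have h1 : ((∑ n ∈ Finset.Icc (-(X : ℤ)) X, ‖∑ i ∈ I, addExp (n * α i)‖ ^ 2 : ℝ) : ℂ) =
      ∑ i ∈ I, ∑ j ∈ I, ∑ n ∈ Finset.Icc (-(X : ℤ)) X, addExp (n * (α i - α j)) := by
    push_cast
    rw [Finset.sum_congr rfl fun i _ => Finset.sum_comm, Finset.sum_comm]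
    refine Finset.sum_congr rfl fun n _ => ?_
    rw [← Complex.mul_conj', map_sum, Finset.sum_mul_sum]
    refine Finset.sum_congr rfl fun i _ => Finset.sum_congr rfl fun j _ => ?_
    rw [star_addExp, ← addExp_add]
    congr 1
    ring
  have hpos : 0 ≤ ∑ n ∈ Finset.Icc (-(X : ℤ)) X, ‖∑ i ∈ I, addExp (n * α i)‖ ^ 2 :=
    Finset.sum_nonneg fun _ _ => by positivity
  rw [← abs_of_nonneg hpos, ← Real.norm_eq_abs, ← Complex.norm_real, h1]
  refine (norm_sum_le _ _).trans ?_
  rw [← nsmul_eq_mul, ← Finset.sum_const]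
  refine Finset.sum_le_sum fun i hi => ?_
  refine (norm_sum_le _ _).trans ?_
  rw [← Finset.add_sum_erase _ _ hi]
  have hdiag : ‖∑ n ∈ Finset.Icc (-(X : ℤ)) X, addExp (n * (α i - α i))‖ ≤ 2 * X + 1 := by
    refine (norm_sum_le _ _).trans ?_
    simp only [norm_addExp, Finset.sum_const, Int.card_Icc, nsmul_eq_mul, mul_one]
    have : ((X : ℤ) + 1 - -(X : ℤ)).toNat = 2 * X + 1 := by omega
    rw [this]
    push_cast
    exact le_rfl
  refine add_le_add hdiag ?_
  -- Representatives in `[-1/2, 1/2]` of the differences mod `1`. Separation mod `1` keeps them away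
  -- from `0` and from one another.
  set b : ι → ℝ := fun j => α i - α j - round (α i - α j) with hbdef
  have hJ : ∀ j ∈ I.erase i, 1 / (X : ℝ) ≤ |b j| := fun j hj =>
    hsep i hi j (Finset.mem_of_mem_erase hj) (Finset.ne_of_mem_erase hj).symm _
  have hX0 : (0 : ℝ) < X := by exact_mod_cast (by omega : 0 < X)
  refine le_trans (Finset.sum_le_sum fun j hj => ?_) (sum_inv_le_of_separated (J := I.erase i)
    (b := b) hX (fun j _ => abs_sub_round _) hJ ?_)
  · refine norm_sum_addExp_le (m := round (α i - α j)) (by simp [hbdef]) (abs_sub_round _) ?_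
    have : 0 < |b j| := lt_of_lt_of_le (by positivity) (hJ j hj)
    exact abs_pos.1 this
  · intro j hj k hk hne
    have := hsep k (Finset.mem_of_mem_erase hk) j (Finset.mem_of_mem_erase hj) hne.symm
      (round (α i - α j) - round (α i - α k))
    convert this using 2
    rw [hbdef]
    push_cast
    ring

/-- The number of representations of `n` as a difference of two elements of `B`. -/
def diffCount (B : Finset ℤ) (n : ℤ) : ℕ := (B.filter fun b => b - n ∈ B).card

theorem sum_diffCount_mul {R : Type*} [CommSemiring R] {B : Finset ℤ} {X : ℕ}
    (hB : B ⊆ Finset.Icc 1 (X : ℤ)) (F : ℤ → R) :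
    ∑ n ∈ Finset.Icc (-(X : ℤ)) X, (diffCount B n : R) * F n =
      ∑ a ∈ B, ∑ b ∈ B, F (a - b) := by
  classical
  have h1 : ∀ a ∈ B, ∑ b ∈ B, F (a - b) =
      ∑ n ∈ Finset.Icc (-(X : ℤ)) X, if a - n ∈ B then F n else 0 := by
    intro a ha
    rw [← Finset.sum_filter]
    have ha' := Finset.mem_Icc.1 (hB ha)
    refine Finset.sum_nbij' (fun b => a - b) (fun n => a - n) ?_ ?_ ?_ ?_ ?_
    · intro b hb
      have hb' := Finset.mem_Icc.1 (hB hb)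
      simp only [Finset.mem_filter, Finset.mem_Icc, sub_sub_cancel]
      exact ⟨⟨by omega, by omega⟩, hb⟩
    · intro n hn
      exact (Finset.mem_filter.1 hn).2
    · simp
    · simp
    · simp
  rw [Finset.sum_congr rfl h1, Finset.sum_comm]
  refine Finset.sum_congr rfl fun n _ => ?_
  rw [← Finset.sum_filter, Finset.sum_const, diffCount, nsmul_eq_mul]

/-- Many large exponential sums over `B` force `B` to have large additive energy. -/
theorem sq_sum_sq_norm_le_sum_sq_diffCount_mul {ι : Type*} {I : Finset ι} {α : ι → ℝ} {X : ℕ}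
    (hX : 2 ≤ X) (hsep : ∀ i ∈ I, ∀ j ∈ I, i ≠ j → ∀ m : ℤ, 1 / (X : ℝ) ≤ |α i - α j - m|)
    {B : Finset ℤ} (hB : B ⊆ Finset.Icc 1 (X : ℤ)) :
    (∑ i ∈ I, ‖∑ a ∈ B, addExp (a * α i)‖ ^ 2) ^ 2 ≤
      (∑ n ∈ Finset.Icc (-(X : ℤ)) X, (diffCount B n : ℝ) ^ 2) *
        (I.card * (2 * X + 1 + 2 * X * (1 + Real.log X))) := by
  have h1 : ((∑ i ∈ I, ‖∑ a ∈ B, addExp (a * α i)‖ ^ 2 : ℝ) : ℂ) =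
      ∑ n ∈ Finset.Icc (-(X : ℤ)) X, (diffCount B n : ℂ) * ∑ i ∈ I, addExp (n * α i) := by
    rw [sum_diffCount_mul hB]
    push_cast
    rw [Finset.sum_congr rfl fun a _ => Finset.sum_comm, Finset.sum_comm]
    refine Finset.sum_congr rfl fun i _ => ?_
    rw [← Complex.mul_conj', map_sum, Finset.sum_mul_sum]
    refine Finset.sum_congr rfl fun a _ => Finset.sum_congr rfl fun b _ => ?_
    rw [star_addExp, ← addExp_add]
    congr 1
    ring
  have h2 : ∑ i ∈ I, ‖∑ a ∈ B, addExp (a * α i)‖ ^ 2 ≤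
      ∑ n ∈ Finset.Icc (-(X : ℤ)) X, (diffCount B n : ℝ) * ‖∑ i ∈ I, addExp (n * α i)‖ := by
    have hpos : 0 ≤ ∑ i ∈ I, ‖∑ a ∈ B, addExp (a * α i)‖ ^ 2 :=
      Finset.sum_nonneg fun _ _ => by positivity
    rw [← abs_of_nonneg hpos, ← Real.norm_eq_abs, ← Complex.norm_real, h1]
    refine (norm_sum_le _ _).trans (le_of_eq (Finset.sum_congr rfl fun n _ => ?_))
    rw [norm_mul, Complex.norm_natCast]
  have hpos : 0 ≤ ∑ i ∈ I, ‖∑ a ∈ B, addExp (a * α i)‖ ^ 2 :=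
    Finset.sum_nonneg fun _ _ => by positivity
  -- Cauchy–Schwarz in `n` separates the energy of `B` from a sum involving only the frequencies.
  calc _ ≤ (∑ n ∈ Finset.Icc (-(X : ℤ)) X, (diffCount B n : ℝ) *
        ‖∑ i ∈ I, addExp (n * α i)‖) ^ 2 := by gcongr
    _ ≤ (∑ n ∈ Finset.Icc (-(X : ℤ)) X, (diffCount B n : ℝ) ^ 2) *
        ∑ n ∈ Finset.Icc (-(X : ℤ)) X, ‖∑ i ∈ I, addExp (n * α i)‖ ^ 2 :=
      Finset.sum_mul_sq_le_sq_mul_sq _ _ _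
    _ ≤ _ := by
      gcongr
      exact sum_sq_norm_sum_addExp_le hX hsep

/-- Fractions `r / p` with distinct prime denominators at most `√X` are `1 / X`-separated mod `1`. -/
theorem one_div_le_abs_div_sub_div {X p q : ℕ} (hp : p.Prime) (hq : q.Prime) (hne : p ≠ q)
    (hX : p * q ≤ X) {r s : ℕ} (hr0 : r ≠ 0) (hr : r < p) (m : ℤ) :
    1 / (X : ℝ) ≤ |(r : ℝ) / p - (s : ℝ) / q - m| := by
  have hp0 : (0 : ℝ) < p := by exact_mod_cast hp.pos
  have hq0 : (0 : ℝ) < q := by exact_mod_cast hq.pos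
  have h1 : (r : ℝ) / p - (s : ℝ) / q - m = ((r * q - s * p - m * (p * q) : ℤ) : ℝ) / (p * q) := by
    push_cast
    field_simp
  have h2 : (r * q - s * p - m * (p * q) : ℤ) ≠ 0 := by
    intro h
    have h3 : (p : ℤ) ∣ (r : ℤ) * q := ⟨s + m * q, by linarith⟩
    have h4 : p ∣ r * q := by exact_mod_cast h3
    rcases hp.dvd_mul.1 h4 with h5 | h5
    · exact absurd (Nat.le_of_dvd (Nat.pos_of_ne_zero hr0) h5) (by omega)
    · exact hne ((Nat.prime_dvd_prime_iff_eq hp hq).1 h5)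
  have h3 : (1 : ℝ) ≤ |((r * q - s * p - m * (p * q) : ℤ) : ℝ)| := by
    exact_mod_cast Int.one_le_abs h2
  have hX' : (p : ℝ) * q ≤ X := by exact_mod_cast hX
  rw [h1, abs_div, abs_of_pos (mul_pos hp0 hq0)]
  exact div_le_div₀ (by positivity) h3 (mul_pos hp0 hq0) hX'

/-! ### Fourier analysis mod `p`. -/

/-- The Fourier transform of the indicator function of `S`. -/
noncomputable def charSum {p : ℕ} [NeZero p] (S : Finset (ZMod p)) (r : ZMod p) : ℂ :=
  ∑ s ∈ S, ZMod.stdAddChar (s * r)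

theorem star_stdAddChar {p : ℕ} [NeZero p] (x : ZMod p) :
    (starRingEnd ℂ) (ZMod.stdAddChar x) = ZMod.stdAddChar (-x) := by
  rw [AddChar.map_neg_eq_conj]

theorem norm_sq_charSum {p : ℕ} [NeZero p] (S : Finset (ZMod p)) (r : ZMod p) :
    ((‖charSum S r‖ ^ 2 : ℝ) : ℂ) =
      ∑ x ∈ S ×ˢ S, ZMod.stdAddChar (r * (x.1 - x.2)) := by
  push_cast
  rw [← Complex.mul_conj', charSum, map_sum, Finset.sum_mul_sum, Finset.sum_product]
  refine Finset.sum_congr rfl fun a _ => Finset.sum_congr rfl fun b _ => ?_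
  rw [star_stdAddChar, ← AddChar.map_add_eq_mul]
  congr 1
  ring

theorem sum_norm_sq_charSum {p : ℕ} [NeZero p] (S : Finset (ZMod p)) :
    ∑ r : ZMod p, ‖charSum S r‖ ^ 2 = p * S.card := by
  have h : ((∑ r : ZMod p, ‖charSum S r‖ ^ 2 : ℝ) : ℂ) = p * S.card := by
    rw [Complex.ofReal_sum]
    simp_rw [norm_sq_charSum]
    rw [Finset.sum_comm]
    simp_rw [AddChar.sum_mulShift _ (ZMod.isPrimitive_stdAddChar p)]
    rw [Finset.sum_product]
    simp_rw [sub_eq_zero]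
    simp [ZMod.card, mul_comm]
  exact_mod_cast h

/-- Expand the fourth power as a sum over quadruples of `S`; orthogonality of characters leaves the
additive ones. -/
theorem sum_norm_pow_four_charSum {p : ℕ} [NeZero p] (S : Finset (ZMod p)) :
    ∑ r : ZMod p, ‖charSum S r‖ ^ 4 = p * (S.addEnergy S : ℝ) := by
  have h : ((∑ r : ZMod p, ‖charSum S r‖ ^ 4 : ℝ) : ℂ) = p * (S.addEnergy S : ℂ) := by
    have h1 : ∀ r : ZMod p, ((‖charSum S r‖ ^ 4 : ℝ) : ℂ) =
        ∑ x ∈ (S ×ˢ S) ×ˢ (S ×ˢ S),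
          ZMod.stdAddChar (r * ((x.1.1 - x.1.2) + (x.2.1 - x.2.2))) := by
      intro r
      rw [show ‖charSum S r‖ ^ 4 = ‖charSum S r‖ ^ 2 * ‖charSum S r‖ ^ 2 by ring,
        Complex.ofReal_mul, norm_sq_charSum, Finset.sum_mul_sum, ← Finset.sum_product']
      refine Finset.sum_congr rfl fun x _ => ?_
      rw [← AddChar.map_add_eq_mul, mul_add]
    rw [Complex.ofReal_sum]
    simp_rw [h1]
    rw [Finset.sum_comm]
    simp_rw [AddChar.sum_mulShift _ (ZMod.isPrimitive_stdAddChar p)]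
    simp_rw [Nat.cast_ite, Nat.cast_zero]
    rw [← Finset.sum_filter, Finset.sum_const, Finset.addEnergy, nsmul_eq_mul, mul_comm, ZMod.card]
    congr 3
    refine Finset.filter_congr fun x _ => ?_
    rw [← sub_eq_zero (a := x.1.1 + x.2.1)]
    rw [show x.1.1 - x.1.2 + (x.2.1 - x.2.2) = x.1.1 + x.2.1 - (x.1.2 + x.2.2) by ring]
  exact_mod_cast h

/-- A set of half the residues with more than the random number of additive quadruples has a
large nontrivial Fourier coefficient. -/
theorem exists_charSum_large {p : ℕ} [NeZero p] (hp3 : 3 ≤ p) {δ : ℝ} (hδ : 0 < δ)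
    (hpδ : 2 ≤ δ * p) {S : Finset (ZMod p)} (hS : (S.card : ℝ) = (p + 1) / 2)
    (hE : (1 / 16 + δ) * (p : ℝ) ^ 3 ≤ (S.addEnergy S : ℝ)) :
    ∃ r : ZMod p, r ≠ 0 ∧ δ / 2 * (p : ℝ) ^ 2 ≤ ‖charSum S r‖ ^ 2 := by
  by_contra! hcon
  have hp3' : (3 : ℝ) ≤ p := by exact_mod_cast hp3
  have h0 : ‖charSum S 0‖ = (p + 1) / 2 := by
    simp [charSum, hS]
  have h4 := sum_norm_pow_four_charSum S
  have h2 := sum_norm_sq_charSum S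
  rw [← Finset.add_sum_erase _ _ (Finset.mem_univ (0 : ZMod p))] at h4 h2
  -- Pull out the supremum of `‖charSum S r‖ ^ 2` over `r ≠ 0`, leaving a second moment controlled
  -- by Parseval. The frequency `0` accounts for the main term `p^4/16`.
  have h5 : ∑ r ∈ Finset.univ.erase (0 : ZMod p), ‖charSum S r‖ ^ 4 ≤
      δ / 2 * (p : ℝ) ^ 2 * ∑ r ∈ Finset.univ.erase (0 : ZMod p), ‖charSum S r‖ ^ 2 := by
    rw [Finset.mul_sum]
    refine Finset.sum_le_sum fun r hr => ?_
    rw [show ‖charSum S r‖ ^ 4 = ‖charSum S r‖ ^ 2 * ‖charSum S r‖ ^ 2 by ring]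
    exact mul_le_mul_of_nonneg_right (hcon r (Finset.ne_of_mem_erase hr)).le (by positivity)
  have h6 : ∑ r ∈ Finset.univ.erase (0 : ZMod p), ‖charSum S r‖ ^ 2 ≤ p * ((p + 1) / 2) := by
    rw [hS] at h2
    have : 0 ≤ ‖charSum S 0‖ ^ 2 := by positivity
    linarith
  have h7 : (p : ℝ) * ((1 / 16 + δ) * (p : ℝ) ^ 3) ≤
      ((p + 1) / 2) ^ 4 + δ / 2 * (p : ℝ) ^ 2 * (p * ((p + 1) / 2)) := by
    calc (p : ℝ) * ((1 / 16 + δ) * (p : ℝ) ^ 3) ≤ p * (S.addEnergy S : ℝ) := by gcongr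
      _ = ‖charSum S 0‖ ^ 4 + ∑ r ∈ Finset.univ.erase (0 : ZMod p), ‖charSum S r‖ ^ 4 := h4.symm
      _ ≤ _ := by
        rw [h0]
        gcongr
        exact h5.trans (by gcongr)
  have h8 : δ / 2 * (p : ℝ) ^ 2 * (p * ((p + 1) / 2)) ≤ δ / 3 * (p : ℝ) ^ 4 := by
    have : 0 ≤ δ * (p : ℝ) ^ 3 := by positivity
    nlinarith
  -- This absorbs the excess of `((p + 1)/2)^4` over `p^4/16`, which is of order `p³`.
  have h9 : 2 * (p : ℝ) ^ 3 ≤ δ * (p : ℝ) ^ 4 := by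
    have : 0 ≤ (p : ℝ) ^ 3 := by positivity
    nlinarith
  nlinarith [pow_pos (by linarith : (0 : ℝ) < p) 2, mul_nonneg (sq_nonneg (p : ℝ)) (by linarith : (0 : ℝ) ≤ p - 3)]

theorem sum_stdAddChar_intCast {p : ℕ} [NeZero p] {S : Finset (ZMod p)} {B : Finset ℤ}
    (hB : ∀ b ∈ B, (b : ZMod p) ∈ S) (r : ZMod p) :
    ∑ b ∈ B, ZMod.stdAddChar ((b : ZMod p) * r) =
      ∑ x ∈ S, (classCount B p x : ℂ) * ZMod.stdAddChar (x * r) := by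
  rw [← Finset.sum_fiberwise_of_maps_to hB]
  refine Finset.sum_congr rfl fun x _ => ?_
  rw [classCount, ← nsmul_eq_mul, ← Finset.sum_const]
  refine Finset.sum_congr rfl fun b hb => ?_
  rw [(Finset.mem_filter.1 hb).2]

/-- If `B` is close to uniformly distributed in `S` mod `p`, its exponential sums inherit the
large values of the Fourier transform of `S`. -/
theorem norm_sum_stdAddChar_ge {p : ℕ} [NeZero p] {S : Finset (ZMod p)} {B : Finset ℤ} {δ : ℝ}
    (hB : ∀ b ∈ B, (b : ZMod p) ∈ S) (hB0 : B.Nonempty) (hδ : 0 < δ)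
    (hdev : (p : ℝ) * (collisions B p / (B.card : ℝ) ^ 2 - 1 / S.card) ≤ δ / 8) {r : ZMod p}
    (hr : δ / 2 * (p : ℝ) ^ 2 ≤ ‖charSum S r‖ ^ 2) :
    δ / 8 * (B.card : ℝ) ^ 2 ≤ ‖∑ b ∈ B, ZMod.stdAddChar ((b : ZMod p) * r)‖ ^ 2 := by
  have hN : (0 : ℝ) < B.card := by exact_mod_cast hB0.card_pos
  obtain ⟨b0, hb0⟩ := hB0
  have hSp : (0 : ℝ) < S.card := by exact_mod_cast Finset.card_pos.2 ⟨_, hB b0 hb0⟩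
  have hSle : (S.card : ℝ) ≤ p := by
    have := Finset.card_le_univ S
    rw [ZMod.card] at this
    exact_mod_cast this
  have hcS : ∑ x ∈ S, (classCount B p x : ℝ) = B.card := by
    have := sum_classCount B p S
    rw [Finset.filter_true_of_mem hB] at this
    exact_mod_cast this
  have hcq : ∑ x ∈ S, (classCount B p x : ℝ) ^ 2 ≤ collisions B p := by
    rw [collisions_eq_sum_sq]
    push_cast
    exact Finset.sum_le_sum_of_subset_of_nonneg (Finset.subset_univ _) fun _ _ _ => by positivity
  -- Deviation of the distribution of `B` on `S` from uniform. Its second moment is bounded by the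
  -- collision excess, hence its `L¹` norm by `√(δ/8)`; the uniform part contributes at least twice
  -- that.
  set g : ZMod p → ℝ := fun x => (classCount B p x : ℝ) / B.card - 1 / S.card with hg
  have hg2 : ∑ x ∈ S, g x ^ 2 ≤ collisions B p / (B.card : ℝ) ^ 2 - 1 / S.card := by
    have : ∀ x, g x ^ 2 = (classCount B p x : ℝ) ^ 2 / (B.card : ℝ) ^ 2 -
        2 / (B.card * S.card) * classCount B p x + 1 / (S.card : ℝ) ^ 2 := by
      intro x
      rw [hg]
      field_simp
      ring
    simp_rw [this]
    rw [Finset.sum_add_distrib, Finset.sum_sub_distrib, ← Finset.sum_div, ← Finset.mul_sum, hcS,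
      Finset.sum_const, nsmul_eq_mul]
    have h1 : (∑ x ∈ S, (classCount B p x : ℝ) ^ 2) / (B.card : ℝ) ^ 2 ≤
      collisions B p / (B.card : ℝ) ^ 2 := by gcongr
    have h2 : 2 / ((B.card : ℝ) * S.card) * B.card = 2 / S.card := by field_simp
    have h3 : (S.card : ℝ) * (1 / (S.card : ℝ) ^ 2) = 1 / S.card := by field_simp
    rw [h2, h3]
    have : 2 / (S.card : ℝ) = 1 / S.card + 1 / S.card := by ring
    linarith
  have hg1 : (∑ x ∈ S, |g x|) ^ 2 ≤ δ / 8 := by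
    calc (∑ x ∈ S, |g x|) ^ 2 ≤ S.card * ∑ x ∈ S, |g x| ^ 2 := sq_sum_le_card_mul_sum_sq
      _ = S.card * ∑ x ∈ S, g x ^ 2 := by simp_rw [sq_abs]
      _ ≤ p * (collisions B p / (B.card : ℝ) ^ 2 - 1 / S.card) := by
        have : 0 ≤ ∑ x ∈ S, g x ^ 2 := Finset.sum_nonneg fun _ _ => sq_nonneg _
        exact mul_le_mul hSle hg2 this (by positivity)
      _ ≤ δ / 8 := hdev
  set s := √(δ / 8) with hs
  have hs0 : 0 ≤ s := Real.sqrt_nonneg _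
  have hss : s ^ 2 = δ / 8 := Real.sq_sqrt (by positivity)
  have hg1' : ∑ x ∈ S, |g x| ≤ s := by
    rw [← hss] at hg1
    exact le_of_sq_le_sq hg1 hs0
  have hr' : 2 * s * p ≤ ‖charSum S r‖ := by
    refine le_of_sq_le_sq ?_ (norm_nonneg _)
    calc (2 * s * p) ^ 2 = 4 * s ^ 2 * (p : ℝ) ^ 2 := by ring
      _ = δ / 2 * (p : ℝ) ^ 2 := by rw [hss]; ring
      _ ≤ _ := hr
  have key : ∑ b ∈ B, ZMod.stdAddChar ((b : ZMod p) * r) =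
      ((B.card : ℝ) : ℂ) * (((1 / S.card : ℝ) : ℂ) * charSum S r +
        ∑ x ∈ S, (g x : ℂ) * ZMod.stdAddChar (x * r)) := by
    rw [sum_stdAddChar_intCast hB, charSum, Finset.mul_sum, ← Finset.sum_add_distrib,
      Finset.mul_sum]
    refine Finset.sum_congr rfl fun x _ => ?_
    rw [← add_mul, ← mul_assoc, ← Complex.ofReal_add, ← Complex.ofReal_mul]
    congr 1
    rw [hg]
    have : (B.card : ℝ) * (1 / S.card + ((classCount B p x : ℝ) / B.card - 1 / S.card)) =
      classCount B p x := by field_simp; ring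
    rw [this]
    simp
  have hnorm : ‖∑ x ∈ S, (g x : ℂ) * ZMod.stdAddChar (x * r)‖ ≤ s := by
    refine (norm_sum_le _ _).trans (le_trans (le_of_eq ?_) hg1')
    refine Finset.sum_congr rfl fun x _ => ?_
    rw [norm_mul, AddChar.norm_apply, mul_one, Complex.norm_real, Real.norm_eq_abs]
  have hmain : 2 * s ≤ ‖((1 / S.card : ℝ) : ℂ) * charSum S r‖ := by
    rw [norm_mul, Complex.norm_real, Real.norm_eq_abs, abs_of_pos (by positivity), one_div,
      inv_mul_eq_div, le_div_iff₀ hSp]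
    calc 2 * s * S.card ≤ 2 * s * p := by gcongr
      _ ≤ _ := hr'
  have hfin : s * B.card ≤ ‖∑ b ∈ B, ZMod.stdAddChar ((b : ZMod p) * r)‖ := by
    rw [key, norm_mul, Complex.norm_real, Real.norm_eq_abs, abs_of_pos hN, mul_comm]
    gcongr
    have := norm_sub_le_norm_add (((1 / S.card : ℝ) : ℂ) * charSum S r)
      (∑ x ∈ S, (g x : ℂ) * ZMod.stdAddChar (x * r))
    linarith
  calc δ / 8 * (B.card : ℝ) ^ 2 = (s * B.card) ^ 2 := by rw [mul_pow, hss]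
    _ ≤ _ := by gcongr

theorem stdAddChar_intCast_mul {p : ℕ} [NeZero p] (b : ℤ) (r : ZMod p) :
    ZMod.stdAddChar ((b : ZMod p) * r) = addExp (b * ((r.val : ℝ) / p)) := by
  have : (b : ZMod p) * r = ((b * r.val : ℤ) : ZMod p) := by
    push_cast
    rw [ZMod.natCast_zmod_val]
  rw [this, ZMod.stdAddChar_coe, addExp]
  congr 1
  push_cast
  ring

/-! ### Almost periods of a half-size set mod `p`. -/

section

open Finset Pointwise

/-- The shifts `t` for which `S` and `S + t` share at least `β` elements. -/
noncomputable def almostPeriods {p : ℕ} [NeZero p] (S : Finset (ZMod p)) (β : ℝ) :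
    Finset (ZMod p) := by
  classical exact univ.filter fun t => β ≤ ((S.filter fun x => x - t ∈ S).card : ℝ)

theorem mem_almostPeriods {p : ℕ} [NeZero p] {S : Finset (ZMod p)} {β : ℝ} {t : ZMod p} :
    t ∈ almostPeriods S β ↔ β ≤ ((S.filter fun x => x - t ∈ S).card : ℝ) := by
  simp [almostPeriods]

/-- `S ∩ (S + s)` and `(S ∩ (S + t)) + s` both lie in `S + s`, so they overlap in at least `2β -
|S|` points, each lying in `S ∩ (S + s + t)`. -/
theorem almostPeriods_add_subset {p : ℕ} [NeZero p] (S : Finset (ZMod p)) (β : ℝ) :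
    almostPeriods S β + almostPeriods S β ⊆ almostPeriods S (2 * β - S.card) := by
  classical
  intro u hu
  obtain ⟨s, hs, t, ht, rfl⟩ := mem_add.1 hu
  rw [mem_almostPeriods] at hs ht ⊢
  -- the elements `x` with `x - s ∈ S` and `x - s - t ∈ S`
  have e : (S.filter fun x => x - t ∈ S).card = ((S.filter fun x => x - t ∈ S).image (· + s)).card :=
    (card_image_of_injective _ (add_left_injective s)).symm
  have h1 := card_union_add_card_inter (S.filter fun x => x - s ∈ S)
    ((S.filter fun x => x - t ∈ S).image (· + s))
  have h2 : ((S.filter fun x => x - s ∈ S) ∪ ((S.filter fun x => x - t ∈ S).image (· + s))).card ≤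
      S.card := by
    rw [← card_image_of_injective S (add_left_injective s)]
    refine card_le_card (union_subset ?_ (image_subset_image (filter_subset _ _)))
    intro x hx
    exact mem_image.2 ⟨x - s, (mem_filter.1 hx).2, by simp⟩
  have h3 : ((S.filter fun x => x - s ∈ S) ∩ ((S.filter fun x => x - t ∈ S).image (· + s))).card ≤
      (S.filter fun x => x - (s + t) ∈ S).card := by
    refine card_le_card fun x hx => ?_
    rw [mem_inter, mem_filter, mem_image] at hx
    obtain ⟨⟨hx1, hx2⟩, y, hy, rfl⟩ := hx
    refine mem_filter.2 ⟨hx1, ?_⟩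
    have := (mem_filter.1 hy).2
    convert this using 1
    ring
  have h4 : ((S.filter fun x => x - s ∈ S).card : ℝ) + (S.filter fun x => x - t ∈ S).card ≤
      S.card + (S.filter fun x => x - (s + t) ∈ S).card := by
    exact_mod_cast (by omega : (S.filter fun x => x - s ∈ S).card +
      (S.filter fun x => x - t ∈ S).card ≤ S.card + (S.filter fun x => x - (s + t) ∈ S).card)
  linarith

/-- Markov's inequality: the overlaps of `S` with all its shifts sum to `|S|²`. -/
theorem card_almostPeriods_mul_le {p : ℕ} [NeZero p] (S : Finset (ZMod p)) (β : ℝ) :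
    (almostPeriods S β).card * β ≤ (S.card : ℝ) ^ 2 := by
  classical
  have h1 : ∑ t : ZMod p, (S.filter fun x => x - t ∈ S).card = S.card ^ 2 := by
    simp_rw [card_filter]
    rw [sum_comm, sq, ← smul_eq_mul, ← sum_const]
    refine sum_congr rfl fun x _ => ?_
    rw [← card_filter]
    refine card_bij (fun t _ => x - t) (fun t ht => (mem_filter.1 ht).2)
      (fun a _ b _ h => sub_right_injective h) fun b hb => ⟨x - b, by simpa using hb, by simp⟩
  calc (almostPeriods S β).card * β = ∑ t ∈ almostPeriods S β, β := by simp
    _ ≤ ∑ t ∈ almostPeriods S β, ((S.filter fun x => x - t ∈ S).card : ℝ) :=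
        sum_le_sum fun t ht => mem_almostPeriods.1 ht
    _ ≤ ∑ t : ZMod p, ((S.filter fun x => x - t ∈ S).card : ℝ) :=
        sum_le_sum_of_subset_of_nonneg (subset_univ _) fun _ _ _ => Nat.cast_nonneg _
    _ = (S.card : ℝ) ^ 2 := by exact_mod_cast h1

/-- Cauchy–Davenport for the sumset above; `h` excludes the case where the sumset is everything. -/
theorem two_mul_card_almostPeriods_le {p : ℕ} [NeZero p] (hp : p.Prime) (S : Finset (ZMod p))
    {β : ℝ} (h : (almostPeriods S (2 * β - S.card)).card < p) :
    2 * (almostPeriods S β).card ≤ (almostPeriods S (2 * β - S.card)).card + 1 := by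
  classical
  rcases (almostPeriods S β).eq_empty_or_nonempty with h0 | h0
  · simp [h0]
  have h1 := ZMod.cauchy_davenport hp h0 h0
  have h2 := card_le_card (almostPeriods_add_subset S β)
  rw [min_le_iff] at h1
  omega

/-- A set of half the residues mod `p` has few shifts that nearly fix it. -/
theorem card_almostPeriods_le {p : ℕ} [NeZero p] (hp : p.Prime) (hp2 : 200 ≤ p)
    {S : Finset (ZMod p)} (hS : (S.card : ℝ) = (p + 1) / 2) :
    ((almostPeriods S ((p : ℝ) * (1 / 2 - 1 / 64))).card : ℝ) ≤ p / 7 := by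
  have hp' : (200 : ℝ) ≤ p := by exact_mod_cast hp2
  -- The deficit `|S| - β` starts near `p/64` and doubles three times, to about `p/8`. At `β3 ≈
  -- 3p/8`, Markov still keeps the almost periods from filling `ZMod p`, so three doublings give
  -- `8|almostPeriods S β0| ≤ p + 7`.
  obtain ⟨β0, h0⟩ : ∃ β, β = (p : ℝ) * (1 / 2 - 1 / 64) := ⟨_, rfl⟩
  obtain ⟨β1, h1⟩ : ∃ β, β = 2 * β0 - S.card := ⟨_, rfl⟩
  obtain ⟨β2, h2⟩ : ∃ β, β = 2 * β1 - S.card := ⟨_, rfl⟩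
  obtain ⟨β3, h3⟩ : ∃ β, β = 2 * β2 - S.card := ⟨_, rfl⟩
  have h4 := card_almostPeriods_mul_le S β3
  have h5 : β3 = p * (3 / 8) - 7 / 2 := by rw [h3, h2, h1, h0, hS]; ring
  have c3 : (almostPeriods S β3).card < p := by
    by_contra! hc
    have hc' : (p : ℝ) ≤ (almostPeriods S β3).card := by exact_mod_cast hc
    rw [hS, h5] at h4
    have : (p : ℝ) * (p * (3 / 8) - 7 / 2) ≤ ((p + 1) / 2) ^ 2 :=
      le_trans (mul_le_mul_of_nonneg_right (h5 ▸ hc') (by linarith)) h4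
    nlinarith
  have d2 := two_mul_card_almostPeriods_le hp S (β := β2) (h3 ▸ c3)
  rw [← h3] at d2
  have d1 := two_mul_card_almostPeriods_le hp S (β := β1) (h2 ▸ by omega)
  rw [← h2] at d1
  have d0 := two_mul_card_almostPeriods_le hp S (β := β0) (h1 ▸ by omega)
  rw [← h1] at d0
  have : 8 * (almostPeriods S β0).card ≤ p + 7 := by omega
  have h6 : 8 * ((almostPeriods S β0).card : ℝ) ≤ p + 7 := by exact_mod_cast this
  rw [← h0]
  linarith

end

/-! ### The larger sieve with half of the residues. -/

/-- The odd primes not exceeding `y`. -/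
noncomputable def oddPrimesUpTo (y : ℝ) : Finset ℕ := (primesUpTo y).erase 2

theorem mem_oddPrimesUpTo {y : ℝ} (hy : 0 ≤ y) {p : ℕ} :
    p ∈ oddPrimesUpTo y ↔ p ≠ 2 ∧ p.Prime ∧ (p : ℝ) ≤ y := by
  rw [oddPrimesUpTo, Finset.mem_erase, mem_primesUpTo hy]

theorem oddPrimesUpTo_prime {y : ℝ} {p : ℕ} (h : p ∈ oddPrimesUpTo y) : p.Prime :=
  primesUpTo_prime (Finset.mem_of_mem_erase h)

theorem sum_log_oddPrimesUpTo_le {y : ℝ} (hy : 0 ≤ y) :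
    ∑ p ∈ oddPrimesUpTo y, Real.log p ≤ 2 * y := by
  have h1 : ∑ p ∈ oddPrimesUpTo y, Real.log p ≤ ∑ p ∈ primesUpTo y, Real.log p :=
    Finset.sum_le_sum_of_subset_of_nonneg (Finset.erase_subset _ _)
      fun p _ _ => Real.log_natCast_nonneg p
  have h2 : Real.log 4 ≤ 2 := by
    rw [show (4 : ℝ) = 2 ^ 2 by norm_num, Real.log_pow]
    push_cast
    linarith [Real.log_two_lt_d9]
  exact h1.trans ((sum_log_primesUpTo_le hy).trans (by gcongr))

/-- Mertens' first theorem for odd primes, in the two forms used for sieving. -/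
theorem exists_mertens_oddPrimes :
    ∃ M : ℝ, 0 < M ∧ ∀ y : ℝ, 1 ≤ y →
      |∑ p ∈ oddPrimesUpTo y, Real.log p / p - Real.log y| ≤ M ∧
      2 * Real.log y - M ≤ ∑ p ∈ oddPrimesUpTo y, Real.log p * (2 / ((p : ℝ) + 1)) := by
  obtain ⟨M, hM0, hM⟩ := exists_abs_sum_log_div_sub_log_le
  obtain ⟨K, hK0, hK⟩ := exists_sum_log_div_mul_le
  refine ⟨2 * (M + 1) + 2 * K, by positivity, fun y hy => ?_⟩
  have h1 := abs_le.1 (hM y hy)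
  have h2 : ∑ p ∈ oddPrimesUpTo y, Real.log p / p ≤ ∑ p ∈ primesUpTo y, Real.log p / p :=
    Finset.sum_le_sum_of_subset_of_nonneg (Finset.erase_subset _ _)
      fun p _ _ => div_nonneg (Real.log_natCast_nonneg p) (Nat.cast_nonneg p)
  have h3 : ∑ p ∈ primesUpTo y, Real.log p / p ≤ ∑ p ∈ oddPrimesUpTo y, Real.log p / p + 1 := by
    by_cases h : 2 ∈ primesUpTo y
    · rw [oddPrimesUpTo, ← Finset.add_sum_erase _ _ h]
      push_cast
      linarith [Real.log_two_lt_d9]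
    · rw [oddPrimesUpTo, Finset.erase_eq_of_notMem h]
      linarith
  have h4 := hK (oddPrimesUpTo y) fun p hp => oddPrimesUpTo_prime hp
  have h5 : 2 * ∑ p ∈ oddPrimesUpTo y, Real.log p / p -
      2 * ∑ p ∈ oddPrimesUpTo y, Real.log p / ((p : ℝ) * (p - 1)) ≤
      ∑ p ∈ oddPrimesUpTo y, Real.log p * (2 / ((p : ℝ) + 1)) := by
    rw [Finset.mul_sum, Finset.mul_sum, ← Finset.sum_sub_distrib]
    refine Finset.sum_le_sum fun p hp => ?_
    have hp2 : (2 : ℝ) ≤ p := by exact_mod_cast (oddPrimesUpTo_prime hp).two_le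
    have e : 2 / (p : ℝ) - 2 / ((p : ℝ) * (p - 1)) ≤ 2 / ((p : ℝ) + 1) := by
      have h0 : (0 : ℝ) < (p : ℝ) - 1 := by linarith
      rw [← sub_nonneg]
      have : 2 / ((p : ℝ) + 1) - (2 / (p : ℝ) - 2 / ((p : ℝ) * (p - 1))) =
          4 / ((p : ℝ) * (p - 1) * (p + 1)) := by
        field_simp
        ring
      rw [this]
      positivity
    calc 2 * (Real.log p / p) - 2 * (Real.log p / ((p : ℝ) * (p - 1))) =
        Real.log p * (2 / (p : ℝ) - 2 / ((p : ℝ) * (p - 1))) := by ring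
      _ ≤ _ := mul_le_mul_of_nonneg_left e (Real.log_natCast_nonneg p)
  constructor
  · rw [abs_le]; constructor <;> linarith
  · linarith

theorem abs_sub_le_of_subset_Icc {X : ℕ} {B : Finset ℤ} (hB : B ⊆ Finset.Icc 1 (X : ℤ)) :
    ∀ b ∈ B, ∀ b' ∈ B, |(b : ℝ) - b'| ≤ X := by
  intro b hb b' hb'
  have h1 := Finset.mem_Icc.1 (hB hb)
  have h2 := Finset.mem_Icc.1 (hB hb')
  have : |b - b'| ≤ (X : ℤ) := by rw [abs_le]; omega
  exact_mod_cast this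

/-- The collision count of a uniform distribution on `T` is the minimum, and serves as the baseline
for measuring deviation. -/
theorem two_div_mul_le_collisions {p : ℕ} (hp : p.Prime) {T : Finset (ZMod p)}
    (hT : (T.card : ℝ) = (p + 1) / 2) {B : Finset ℤ} (hB : ∀ b ∈ B, (b : ZMod p) ∈ T) :
    (2 / ((p : ℝ) + 1)) * (B.card : ℝ) ^ 2 ≤ collisions B p := by
  have : NeZero p := ⟨hp.ne_zero⟩
  have h := sq_card_le_card_mul_collisions hB
  rw [hT] at h
  have hp0 : (0 : ℝ) < (p : ℝ) + 1 := by positivity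
  rw [div_mul_eq_mul_div, div_le_iff₀ hp0]
  linarith

/-- The larger sieve bound for sets occupying half of the residues mod each odd prime. -/
theorem exists_card_le_mul_sqrt :
    ∃ C : ℝ, 0 < C ∧ ∀ (X : ℕ) (S : (p : ℕ) → Finset (ZMod p)) (B : Finset ℤ), 1 ≤ X →
      B ⊆ Finset.Icc 1 (X : ℤ) →
      (∀ p : ℕ, p.Prime → p ≠ 2 → (p : ℝ) ≤ (X : ℝ) ^ (1 / 2 : ℝ) →
        ((S p).card : ℝ) = ((p : ℝ) + 1) / 2) →
      (∀ p : ℕ, p.Prime → p ≠ 2 → (p : ℝ) ≤ (X : ℝ) ^ (1 / 2 : ℝ) →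
        ∀ b ∈ B, (b : ZMod p) ∈ S p) →
      (B.card : ℝ) ≤ C * (X : ℝ) ^ (1 / 2 : ℝ) := by
  obtain ⟨M, hM0, hM⟩ := exists_mertens_oddPrimes
  refine ⟨2 * Real.exp (3 * M + 1), by positivity, fun X S B hX hB hS hBS => ?_⟩
  have hX1 : (1 : ℝ) ≤ X := by exact_mod_cast hX
  set N : ℝ := (B.card : ℝ) with hN
  rcases (Nat.cast_nonneg (α := ℝ) B.card).eq_or_lt with h0 | h0
  · rw [hN, ← h0]; positivity
  rw [← hN] at h0
  set s : ℝ := (X : ℝ) ^ (1 / 2 : ℝ) with hs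
  have hs1 : 1 ≤ s := Real.one_le_rpow hX1 (by norm_num)
  have hls : Real.log s = 1 / 2 * Real.log X := Real.log_rpow (by linarith) _
  -- Sieving slightly beyond `√X`, with only the trivial `collisions ≥ N²/p` there, gains `log T -
  -- 2M = M + 1`. This beats the loss `M` below `√X` and leaves a net gain of `1`.
  set T : ℝ := Real.exp (3 * M + 1) with hT
  have hT1 : 1 ≤ T := Real.one_le_exp (by positivity)
  have hTs : s ≤ T * s := by nlinarith
  have hTs1 : 1 ≤ T * s := by linarith
  have hlT : Real.log (T * s) = 3 * M + 1 + 1 / 2 * Real.log X := by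
    rw [Real.log_mul (by positivity) (by positivity), hls, hT, Real.log_exp]
  have h1 := sum_log_mul_collisions_le hX1 (abs_sub_le_of_subset_Icc hB)
    (P := oddPrimesUpTo (T * s)) fun p hp => oddPrimesUpTo_prime hp
  have h2 := sum_log_oddPrimesUpTo_le (y := T * s) (by linarith)
  have hfil : (oddPrimesUpTo (T * s)).filter (fun p : ℕ => (p : ℝ) ≤ s) = oddPrimesUpTo s := by
    ext p
    rw [Finset.mem_filter, mem_oddPrimesUpTo (by linarith), mem_oddPrimesUpTo (by linarith)]
    constructor
    · rintro ⟨⟨a, b, _⟩, c⟩; exact ⟨a, b, c⟩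
    · rintro ⟨a, b, c⟩; exact ⟨⟨a, b, c.trans hTs⟩, c⟩
  have h3 : N ^ 2 * (∑ p ∈ oddPrimesUpTo s, Real.log p * (2 / ((p : ℝ) + 1)) +
      (∑ p ∈ oddPrimesUpTo (T * s), Real.log p / p - ∑ p ∈ oddPrimesUpTo s, Real.log p / p)) ≤
      ∑ p ∈ oddPrimesUpTo (T * s), Real.log p * collisions B p := by
    rw [← Finset.sum_filter_add_sum_filter_not (oddPrimesUpTo (T * s)) (fun p : ℕ => (p : ℝ) ≤ s)
      (fun p => Real.log p / p), ← Finset.sum_filter_add_sum_filter_not (oddPrimesUpTo (T * s))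
      (fun p : ℕ => (p : ℝ) ≤ s) (fun p => Real.log p * collisions B p), hfil, add_sub_cancel_left,
      mul_add, Finset.mul_sum, Finset.mul_sum]
    refine add_le_add (Finset.sum_le_sum fun p hp => ?_) (Finset.sum_le_sum fun p hp => ?_)
    · obtain ⟨hp2, hpp, hps⟩ := (mem_oddPrimesUpTo (by linarith)).1 hp
      have := two_div_mul_le_collisions hpp (hS p hpp hp2 hps) (hBS p hpp hp2 hps)
      have hl := Real.log_natCast_nonneg p
      calc N ^ 2 * (Real.log p * (2 / ((p : ℝ) + 1))) =
          Real.log p * ((2 / ((p : ℝ) + 1)) * N ^ 2) := by ring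
        _ ≤ _ := mul_le_mul_of_nonneg_left this hl
    · have hpp := oddPrimesUpTo_prime (Finset.mem_filter.1 hp).1
      have : NeZero p := ⟨hpp.ne_zero⟩
      have hp0 : (0 : ℝ) < p := by exact_mod_cast hpp.pos
      have := sq_card_le_mul_collisions B p
      have hl := Real.log_natCast_nonneg p
      calc N ^ 2 * (Real.log p / p) = Real.log p * (N ^ 2 / p) := by ring
        _ ≤ _ := by
          refine mul_le_mul_of_nonneg_left ?_ hl
          rw [div_le_iff₀ hp0, mul_comm]
          exact this
  have h4 := (hM s hs1).2
  have h5 := abs_le.1 (hM s hs1).1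
  have h6 := abs_le.1 (hM (T * s) hTs1).1
  rw [hlT] at h6
  rw [hls] at h4 h5
  have h7 : N ^ 2 * (Real.log X + 1) ≤ N ^ 2 * Real.log X + N * (2 * (T * s)) := by
    calc N ^ 2 * (Real.log X + 1) ≤ N ^ 2 * (∑ p ∈ oddPrimesUpTo s, Real.log p * (2 / ((p : ℝ) + 1)) +
      (∑ p ∈ oddPrimesUpTo (T * s), Real.log p / p - ∑ p ∈ oddPrimesUpTo s, Real.log p / p)) := by
          refine mul_le_mul_of_nonneg_left ?_ (by positivity)
          linarith [h5.1, h5.2, h6.1, h6.2]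
      _ ≤ _ := h3.trans (h1.trans (by gcongr))
  have h8 : N * N ≤ N * (2 * T * s) := by nlinarith
  exact le_of_mul_le_mul_left h8 h0

/-- A large set occupying half of the residues mod each odd prime is, on average, nearly uniformly
distributed in these. -/
theorem sum_log_mul_deviation_le {M : ℝ}
    (hM : ∀ y : ℝ, 1 ≤ y →
      2 * Real.log y - M ≤ ∑ p ∈ oddPrimesUpTo y, Real.log p * (2 / ((p : ℝ) + 1)))
    {X : ℕ} (hX : 1 ≤ X) {S : (p : ℕ) → Finset (ZMod p)} {B : Finset ℤ}
    (hB : B ⊆ Finset.Icc 1 (X : ℤ)) {y : ℝ} (hy : 1 ≤ y) (hyB : y ≤ B.card)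
    (hS : ∀ p ∈ oddPrimesUpTo y, ((S p).card : ℝ) = ((p : ℝ) + 1) / 2) :
    ∑ p ∈ oddPrimesUpTo y,
        Real.log p * (collisions B p / (B.card : ℝ) ^ 2 - 1 / (S p).card) ≤
      Real.log X - 2 * Real.log y + 2 + M := by
  have hX1 : (1 : ℝ) ≤ X := by exact_mod_cast hX
  have hN : (0 : ℝ) < B.card := by linarith
  have h1 := sum_log_mul_collisions_le hX1 (abs_sub_le_of_subset_Icc hB)
    (P := oddPrimesUpTo y) fun p hp => oddPrimesUpTo_prime hp
  have h2 := sum_log_oddPrimesUpTo_le (y := y) (by linarith)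
  have h3 : ∑ p ∈ oddPrimesUpTo y, Real.log p * (collisions B p / (B.card : ℝ) ^ 2) ≤
      Real.log X + 2 := by
    have : ∑ p ∈ oddPrimesUpTo y, Real.log p * (collisions B p / (B.card : ℝ) ^ 2) =
        (∑ p ∈ oddPrimesUpTo y, Real.log p * collisions B p) / (B.card : ℝ) ^ 2 := by
      rw [Finset.sum_div]
      exact Finset.sum_congr rfl fun p _ => by ring
    rw [this, div_le_iff₀ (by positivity)]
    refine h1.trans ?_
    -- Here `y ≤ |B|` makes the diagonal term only `O(|B|²)`.
    have : (B.card : ℝ) * ∑ p ∈ oddPrimesUpTo y, Real.log p ≤ B.card * (2 * B.card) := by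
      gcongr; linarith
    nlinarith
  have h4 : ∑ p ∈ oddPrimesUpTo y, Real.log p * (1 / ((S p).card : ℝ)) =
      ∑ p ∈ oddPrimesUpTo y, Real.log p * (2 / ((p : ℝ) + 1)) :=
    Finset.sum_congr rfl fun p hp => by rw [hS p hp, one_div_div]
  simp_rw [mul_sub]
  rw [Finset.sum_sub_distrib, h4]
  linarith [hM y hy]

/-! ### Lower bound for the additive energy. -/

open Filter in
theorem eventually_mul_log_pow_le_rpow (K : ℝ) (k : ℕ) {a : ℝ} (ha : 0 < a) :
    ∀ᶠ X : ℕ in atTop, K * Real.log X ^ k ≤ (X : ℝ) ^ a := by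
  have h := (isLittleO_log_rpow_rpow_atTop (k : ℝ) ha).comp_tendsto tendsto_natCast_atTop_atTop
  have h2 := h.def (c := 1 / (|K| + 1)) (by positivity)
  filter_upwards [h2, eventually_ge_atTop 1] with X hX hX1
  have hX1' : (1 : ℝ) ≤ X := by exact_mod_cast hX1
  have hl := Real.log_nonneg hX1'
  simp only [Function.comp_apply, Real.rpow_natCast, Real.norm_eq_abs] at hX
  rw [abs_of_nonneg (pow_nonneg hl k), abs_of_nonneg (Real.rpow_nonneg (by linarith) a),
    one_div_mul_eq_div,
    le_div_iff₀ (by positivity)] at hX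
  have : 0 ≤ Real.log X ^ k := by positivity
  nlinarith [le_abs_self K]

open Filter in
set_option maxHeartbeats 1000000 in
/-- A near-extremal set whose residue classes have large additive energy mod each odd prime has
itself large additive energy. -/
theorem exists_sum_sq_diffCount_ge {ε : ℝ} (hε : 0 < ε) (hε1 : ε ≤ 1) :
    ∃ c : ℝ, 0 < c ∧ c ≤ ε ∧ ∃ K : ℝ, 0 < K ∧ ∀ᶠ X : ℕ in atTop,
      ∀ (δ : ℝ) (S : (p : ℕ) → Finset (ZMod p)) (B : Finset ℤ), 0 < δ → δ ≤ 1 →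
      K ≤ δ * Real.log X → B ⊆ Finset.Icc 1 (X : ℤ) →
      (∀ p : ℕ, p.Prime → p ≠ 2 → (p : ℝ) ≤ (X : ℝ) ^ (1 / 2 : ℝ) →
        ((S p).card : ℝ) = ((p : ℝ) + 1) / 2) →
      (∀ p : ℕ, p.Prime → p ≠ 2 → (p : ℝ) ≤ (X : ℝ) ^ (1 / 2 : ℝ) →
        (1 / 16 + δ) * (p : ℝ) ^ 3 ≤ ((S p).addEnergy (S p) : ℝ)) →
      (∀ p : ℕ, p.Prime → p ≠ 2 → (p : ℝ) ≤ (X : ℝ) ^ (1 / 2 : ℝ) →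
        ∀ b ∈ B, (b : ZMod p) ∈ S p) →
      (X : ℝ) ^ (1 / 2 - c * δ : ℝ) ≤ B.card →
      (B.card : ℝ) ^ 3 * (X : ℝ) ^ (-ε) ≤
        ∑ n ∈ Finset.Icc (-(X : ℤ)) X, (diffCount B n : ℝ) ^ 2 := by
  classical
  obtain ⟨M, hM0, hM⟩ := exists_mertens_oddPrimes
  -- The loss is `X^(-2c₁)` from `u * N ≥ X^(1 - 2c₁)`, and another `X^(-2c₁)` pays for logarithms
  -- and constants. `K` makes the `O(1)` terms, even after division by `δ`, small against `c₁ log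
  -- X`.
  set c₁ : ℝ := ε / 4 with hc₁
  set K : ℝ := 80 * (2 + M) / c₁ + 1 with hK
  have hc₁0 : 0 < c₁ := by positivity
  have hK1 : 1 ≤ K := by rw [hK]; linarith [show 0 ≤ 80 * (2 + M) / c₁ by positivity]
  have hKc : 80 * (2 + M) ≤ c₁ * K := by
    have : c₁ * K = 80 * (2 + M) + c₁ := by rw [hK]; field_simp
    linarith
  refine ⟨c₁ / 100, by positivity, by linarith, K, by linarith, ?_⟩
  filter_upwards [eventually_mul_log_pow_le_rpow (896 / c₁) 3 (show 0 < 2 * c₁ by positivity),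
    eventually_mul_log_pow_le_rpow 2 1 (show 0 < 1 / 2 - c₁ by linarith),
    eventually_ge_atTop 9] with X hXlog hXlog2 hX9 δ S B hδ0 hδ1 hδK hB hS hE hBS hcard
  have hX9' : (9 : ℝ) ≤ X := by exact_mod_cast hX9
  have hX0 : (0 : ℝ) < X := by linarith
  set L := Real.log X with hL
  have hL1 : 1 ≤ L := by
    rw [hL, Real.le_log_iff_exp_le hX0]
    linarith [Real.exp_one_lt_d9]
  have hLK : K ≤ L := hδK.trans (by nlinarith)
  set N : ℝ := (B.card : ℝ) with hN
  set y : ℝ := (X : ℝ) ^ (1 / 2 - c₁ / 100 * δ : ℝ) with hy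
  set u : ℝ := (X : ℝ) ^ (1 / 2 - c₁ : ℝ) with hu
  have hu1 : 1 ≤ u := Real.one_le_rpow (by linarith) (by linarith)
  have hcδ : c₁ / 100 * δ ≤ c₁ / 100 := by nlinarith
  have huy : u ≤ y := Real.rpow_le_rpow_of_exponent_le (by linarith) (by linarith)
  have hys : y ≤ (X : ℝ) ^ (1 / 2 : ℝ) :=
    Real.rpow_le_rpow_of_exponent_le (by linarith) (by
      have : 0 ≤ c₁ / 100 * δ := by positivity
      linarith)
  have hy1 : 1 ≤ y := hu1.trans huy
  have hy0 : 0 ≤ y := by linarith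
  have hly : Real.log y = (1 / 2 - c₁ / 100 * δ) * L := Real.log_rpow hX0 _
  have hlu : Real.log u = (1 / 2 - c₁) * L := Real.log_rpow hX0 _
  have hN0 : 0 < N := by linarith
  have hNe : B.Nonempty := by
    rw [hN] at hN0
    exact Finset.card_pos.1 (by exact_mod_cast hN0)
  have hss : (X : ℝ) ^ (1 / 2 : ℝ) * (X : ℝ) ^ (1 / 2 : ℝ) = X := by
    rw [← Real.rpow_add hX0]; norm_num
  have hXle : (X : ℝ) ^ (1 / 2 : ℝ) ≤ X := by
    calc (X : ℝ) ^ (1 / 2 : ℝ) ≤ (X : ℝ) ^ (1 : ℝ) :=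
          Real.rpow_le_rpow_of_exponent_le (by linarith) (by norm_num)
      _ = X := Real.rpow_one _
  -- the deviation from uniform distribution
  set dev : ℕ → ℝ := fun p => collisions B p / N ^ 2 - 1 / (S p).card with hdev
  have hmem : ∀ p ∈ oddPrimesUpTo y, p.Prime ∧ p ≠ 2 ∧ (p : ℝ) ≤ (X : ℝ) ^ (1 / 2 : ℝ) := by
    intro p hp
    obtain ⟨h1, h2, h3⟩ := (mem_oddPrimesUpTo hy0).1 hp
    exact ⟨h2, h1, h3.trans hys⟩
  have hdev_sum : ∑ p ∈ oddPrimesUpTo y, Real.log p * dev p ≤ L - 2 * Real.log y + 2 + M :=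
    sum_log_mul_deviation_le (fun y hy => (hM y hy).2) (by omega) hB hy1 hcard fun p hp =>
      hS p (hmem p hp).1 (hmem p hp).2.1 (hmem p hp).2.2
  have hdev0 : ∀ p ∈ oddPrimesUpTo y, 0 ≤ dev p := by
    intro p hp
    obtain ⟨h1, h2, h3⟩ := hmem p hp
    have := two_div_mul_le_collisions h1 (hS p h1 h2 h3) (hBS p h1 h2 h3)
    rw [hdev]
    simp only
    rw [hS p h1 h2 h3, one_div_div, sub_nonneg, le_div_iff₀ (by positivity)]
    exact this
  -- primes for which the deviation is small
  set I := (oddPrimesUpTo y).filter (fun p : ℕ => u < p) with hI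
  set G := I.filter (fun p : ℕ => p * dev p ≤ δ / 8) with hG
  have hbad : ∑ p ∈ I.filter (fun p : ℕ => ¬ p * dev p ≤ δ / 8), Real.log p / p ≤
      (8 / δ) * (L - 2 * Real.log y + 2 + M) := by
    have h1 : ∑ p ∈ I.filter (fun p : ℕ => ¬ p * dev p ≤ δ / 8), Real.log p / p ≤
        ∑ p ∈ I.filter (fun p : ℕ => ¬ p * dev p ≤ δ / 8), (8 / δ) * (Real.log p * dev p) := by
      refine Finset.sum_le_sum fun p hp => ?_
      rw [Finset.mem_filter, not_le] at hp
      have hp0 : (0 : ℝ) < p := by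
        exact_mod_cast (oddPrimesUpTo_prime (Finset.mem_filter.1 hp.1).1).pos
      have hl := Real.log_natCast_nonneg p
      have h2 : 1 / (p : ℝ) ≤ 8 / δ * dev p := by
        rw [div_le_iff₀ hp0]
        calc (1 : ℝ) = 8 / δ * (δ / 8) := by field_simp
          _ ≤ 8 / δ * (p * dev p) := by gcongr; exact hp.2.le
          _ = _ := by ring
      calc Real.log p / p = Real.log p * (1 / p) := by ring
        _ ≤ Real.log p * (8 / δ * dev p) := by gcongr
        _ = _ := by ring
    refine h1.trans ?_
    rw [← Finset.mul_sum]
    refine mul_le_mul_of_nonneg_left (le_trans ?_ hdev_sum) (by positivity)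
    refine Finset.sum_le_sum_of_subset_of_nonneg
      ((Finset.filter_subset _ _).trans (Finset.filter_subset _ _)) fun p hp _ => ?_
    exact mul_nonneg (Real.log_natCast_nonneg p) (hdev0 p hp)
  have hItot : c₁ * L - c₁ / 100 * L - 2 * M ≤ ∑ p ∈ I, Real.log p / p := by
    have h1 := Finset.sum_filter_add_sum_filter_not (oddPrimesUpTo y) (fun p : ℕ => u < p)
      (fun p => Real.log p / (p : ℝ))
    have h2 : (oddPrimesUpTo y).filter (fun p : ℕ => ¬ u < p) = oddPrimesUpTo u := by
      ext p
      rw [Finset.mem_filter, mem_oddPrimesUpTo hy0, mem_oddPrimesUpTo (by linarith), not_lt]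
      constructor
      · rintro ⟨⟨a, b, _⟩, c⟩; exact ⟨a, b, c⟩
      · rintro ⟨a, b, c⟩; exact ⟨⟨a, b, c.trans huy⟩, c⟩
    rw [h2] at h1
    have h3 := abs_le.1 (hM y hy1).1
    have h4 := abs_le.1 (hM u hu1).1
    rw [hly] at h3
    rw [hlu] at h4
    have h5 : c₁ / 100 * δ * L ≤ c₁ / 100 * L := by gcongr
    rw [hI]
    linarith [h3.1, h4.2]
  have hGtot : c₁ / 2 * L ≤ ∑ p ∈ G, Real.log p / p := by
    have h1 := Finset.sum_filter_add_sum_filter_not I (fun p : ℕ => p * dev p ≤ δ / 8)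
      (fun p => Real.log p / (p : ℝ))
    have h2 : (8 / δ) * (L - 2 * Real.log y + 2 + M) ≤ (16 / 100) * c₁ * L + c₁ / 10 * L := by
      rw [hly]
      have h3 : 8 * (2 + M) ≤ c₁ / 10 * (δ * L) := by nlinarith
      have h4 : (8 / δ) * (L - 2 * ((1 / 2 - c₁ / 100 * δ) * L) + 2 + M) =
          (16 / 100) * c₁ * L + (8 * (2 + M)) / δ := by field_simp; ring
      rw [h4]
      have : (8 * (2 + M)) / δ ≤ c₁ / 10 * L := by
        rw [div_le_iff₀ hδ0]; linarith
      linarith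
    have h5 : 80 * (2 + M) ≤ c₁ * L := hKc.trans (by gcongr)
    rw [← hG] at h1
    nlinarith
  have hGu : c₁ / 2 * u ≤ G.card := by
    have h1 : ∑ p ∈ G, Real.log p / p ≤ ∑ p ∈ G, L / u := by
      refine Finset.sum_le_sum fun p hp => ?_
      have hpI := (Finset.mem_filter.1 (Finset.mem_filter.1 hp).1)
      have hpm := hmem p hpI.1
      refine div_le_div₀ (by linarith) ?_ (by linarith) hpI.2.le
      exact Real.log_le_log (by exact_mod_cast hpm.1.pos) (hpm.2.2.trans hXle)
    rw [Finset.sum_const, nsmul_eq_mul] at h1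
    have h2 := hGtot.trans h1
    rw [← mul_div_assoc, le_div_iff₀ (by linarith)] at h2
    have h3 : (c₁ / 2 * u) * L ≤ G.card * L := by linarith
    exact le_of_mul_le_mul_right h3 (by linarith)
  -- the frequencies
  have hfreq : ∀ p ∈ G, ∃ r : ℕ, r ≠ 0 ∧ r < p ∧
      δ / 8 * N ^ 2 ≤ ‖∑ a ∈ B, addExp (a * ((r : ℝ) / p))‖ ^ 2 := by
    intro p hp
    have hpG := Finset.mem_filter.1 hp
    have hpI := Finset.mem_filter.1 hpG.1
    obtain ⟨h1, h2, h3⟩ := hmem p hpI.1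
    have : NeZero p := ⟨h1.ne_zero⟩
    have hp3 : 3 ≤ p := by
      have := h1.two_le
      omega
    have hpδ : 2 ≤ δ * p := by
      rw [pow_one] at hXlog2
      have h5 : 2 * L ≤ p := hXlog2.trans hpI.2.le
      nlinarith
    obtain ⟨r, hr0, hr⟩ := exists_charSum_large hp3 hδ0 hpδ (hS p h1 h2 h3) (hE p h1 h2 h3)
    refine ⟨r.val, ?_, ZMod.val_lt r, ?_⟩
    · rwa [Ne, ZMod.val_eq_zero]
    · have := norm_sum_stdAddChar_ge (hBS p h1 h2 h3) hNe hδ0 hpG.2 hr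
      simp_rw [stdAddChar_intCast_mul] at this
      exact this
  choose! r hr0 hrp hr using hfreq
  have hsep : ∀ p ∈ G, ∀ q ∈ G, p ≠ q → ∀ m : ℤ,
      1 / (X : ℝ) ≤ |(r p : ℝ) / p - (r q : ℝ) / q - m| := by
    intro p hp q hq hne m
    have hp' := hmem p (Finset.mem_filter.1 (Finset.mem_filter.1 hp).1).1
    have hq' := hmem q (Finset.mem_filter.1 (Finset.mem_filter.1 hq).1).1
    refine one_div_le_abs_div_sub_div hp'.1 hq'.1 hne ?_ (hr0 p hp) (hrp p hp) m
    have : (p : ℝ) * q ≤ X := by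
      rw [← hss]
      exact mul_le_mul hp'.2.2 hq'.2.2 (by positivity) (by positivity)
    exact_mod_cast this
  have hls := sq_sum_sq_norm_le_sum_sq_diffCount_mul (by omega) hsep hB
  set E := ∑ n ∈ Finset.Icc (-(X : ℤ)) X, (diffCount B n : ℝ) ^ 2 with hEdef
  have hE0 : 0 ≤ E := Finset.sum_nonneg fun _ _ => by positivity
  have hlow : G.card * (δ / 8 * N ^ 2) ≤
      ∑ p ∈ G, ‖∑ a ∈ B, addExp (a * ((r p : ℝ) / p))‖ ^ 2 := by
    rw [← nsmul_eq_mul, ← Finset.sum_const]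
    exact Finset.sum_le_sum hr
  have hG0 : (0 : ℝ) < G.card := lt_of_lt_of_le (by positivity) hGu
  have h1 : (G.card * (δ / 8 * N ^ 2)) ^ 2 ≤ E * (G.card * (7 * X * L)) := by
    refine le_trans (by gcongr) (hls.trans ?_)
    gcongr
    nlinarith
  have h2 : G.card * (δ / 8 * N ^ 2) ^ 2 ≤ E * (7 * X * L) := by
    have : (G.card : ℝ) * (G.card * (δ / 8 * N ^ 2) ^ 2) ≤ G.card * (E * (7 * X * L)) := by
      linarith
    exact le_of_mul_le_mul_left this hG0
  -- `δ ≥ 1/log X`, as `K ≥ 1`; so `δ` costs only logarithms.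
  have h3 : c₁ / 2 * u * (1 / (8 * L) * N ^ 2) ^ 2 ≤ E * (7 * X * L) := by
    refine le_trans ?_ h2
    have : 1 / (8 * L) ≤ δ / 8 := by
      rw [div_le_div_iff₀ (by positivity) (by norm_num)]
      linarith
    gcongr
  have h4 : (X : ℝ) * (X : ℝ) ^ (-2 * c₁) ≤ u * N := by
    calc (X : ℝ) * (X : ℝ) ^ (-2 * c₁) = (X : ℝ) ^ (1 + -2 * c₁) := by
          rw [Real.rpow_add hX0, Real.rpow_one]
      _ ≤ (X : ℝ) ^ ((1 / 2 - c₁) + (1 / 2 - c₁ / 100 * δ)) :=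
          Real.rpow_le_rpow_of_exponent_le (by linarith) (by linarith)
      _ = u * y := by rw [Real.rpow_add hX0]
      _ ≤ u * N := by gcongr
  have h5 : (X : ℝ) ^ (-ε) * L ^ 3 * (896 / c₁) ≤ (X : ℝ) ^ (-2 * c₁) := by
    calc (X : ℝ) ^ (-ε) * L ^ 3 * (896 / c₁) = (X : ℝ) ^ (-ε) * (896 / c₁ * L ^ 3) := by ring
      _ ≤ (X : ℝ) ^ (-ε) * (X : ℝ) ^ (2 * c₁) := by gcongr
      _ = _ := by rw [← Real.rpow_add hX0, hc₁]; congr 1; ring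
  have h6 : (N ^ 3 * (X : ℝ) ^ (-ε)) * (7 * X * L) ≤ E * (7 * X * L) := by
    refine le_trans ?_ h3
    have e1 : c₁ / 2 * u * (1 / (8 * L) * N ^ 2) ^ 2 = c₁ / (128 * L ^ 2) * N ^ 3 * (u * N) := by
      field_simp
      ring
    rw [e1]
    calc (N ^ 3 * (X : ℝ) ^ (-ε)) * (7 * X * L)
        = c₁ / (128 * L ^ 2) * N ^ 3 * (X * ((X : ℝ) ^ (-ε) * L ^ 3 * (896 / c₁))) := by
          field_simp
          ring
      _ ≤ c₁ / (128 * L ^ 2) * N ^ 3 * (X * (X : ℝ) ^ (-2 * c₁)) := by gcongr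
      _ ≤ _ := by gcongr
  exact le_of_mul_le_mul_right h6 (by positivity)

/-! ### Popular differences and the upper bound for the additive energy. -/

/-- If all values of `r` are at most `N` and the mass of `r ^ 2` exceeds that allowed by small
values, then many values of `r` are large. -/
theorem card_filter_ge_of_sum_sq_ge {ι : Type*} {J : Finset ι} {r : ι → ℝ} {N η : ℝ} (hN : 0 < N) (hη : 0 ≤ η)
    (h0 : ∀ i ∈ J, 0 ≤ r i) (hr : ∀ i ∈ J, r i ≤ N) (h1 : ∑ i ∈ J, r i = N ^ 2)
    (h2 : N ^ 3 * η ≤ ∑ i ∈ J, r i ^ 2) :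
    η * N / 2 ≤ (J.filter fun i => η * N / 2 ≤ r i).card := by
  have h3 := Finset.sum_filter_add_sum_filter_not J (fun i => η * N / 2 ≤ r i) (fun i => r i ^ 2)
  have h4 : ∑ i ∈ J.filter (fun i => η * N / 2 ≤ r i), r i ^ 2 ≤
      (J.filter fun i => η * N / 2 ≤ r i).card * N ^ 2 := by
    rw [← nsmul_eq_mul, ← Finset.sum_const]
    refine Finset.sum_le_sum fun i hi => ?_
    have := Finset.mem_filter.1 hi
    exact pow_le_pow_left₀ (h0 i this.1) (hr i this.1) 2
  have h5 : ∑ i ∈ J.filter (fun i => ¬ η * N / 2 ≤ r i), r i ^ 2 ≤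
      ∑ i ∈ J, η * N / 2 * r i := by
    calc ∑ i ∈ J.filter (fun i => ¬ η * N / 2 ≤ r i), r i ^ 2
        ≤ ∑ i ∈ J.filter (fun i => ¬ η * N / 2 ≤ r i), η * N / 2 * r i := by
          refine Finset.sum_le_sum fun i hi => ?_
          have := Finset.mem_filter.1 hi
          rw [sq]
          exact mul_le_mul_of_nonneg_right (not_le.1 this.2).le (h0 i this.1)
      _ ≤ _ := by
          exact Finset.sum_le_sum_of_subset_of_nonneg (Finset.filter_subset _ _)
            fun i hi _ => mul_nonneg (by positivity) (h0 i hi)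
  rw [← Finset.mul_sum, h1] at h5
  have h6 : (η * N / 2) * N ^ 2 ≤ (J.filter fun i => η * N / 2 ≤ r i).card * N ^ 2 := by
    have : N ^ 3 * η = (η * N / 2) * N ^ 2 + (η * N / 2) * N ^ 2 := by ring
    linarith
  exact le_of_mul_le_mul_right h6 (by positivity)

/-- If `B` and `B + d` have a large intersection, then `S p` and `S p + d` have a large
intersection for most odd primes `p`. -/
theorem sum_log_div_not_almostPeriod_le {M : ℝ}
    (hM : ∀ y : ℝ, 1 ≤ y →
      2 * Real.log y - M ≤ ∑ p ∈ oddPrimesUpTo y, Real.log p * (2 / ((p : ℝ) + 1)))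
    {X : ℕ} (hX : 1 ≤ X) {S : (p : ℕ) → Finset (ZMod p)} {B : Finset ℤ}
    (hB : B ⊆ Finset.Icc 1 (X : ℤ)) {z : ℝ} (hz : 1 ≤ z)
    (hS : ∀ p ∈ oddPrimesUpTo z, ((S p).card : ℝ) = ((p : ℝ) + 1) / 2)
    (hBS : ∀ p ∈ oddPrimesUpTo z, ∀ b ∈ B, (b : ZMod p) ∈ S p)
    {d : ℤ} (hd : z ≤ diffCount B d) :
    ∑ p ∈ (oddPrimesUpTo z).filter (fun p : ℕ =>
        ¬ (p : ℝ) * (1 / 2 - 1 / 64) ≤ (((S p).filter fun x => x - (d : ZMod p) ∈ S p).card : ℝ)),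
      Real.log p / p ≤ 31 / 2 * (Real.log X - 2 * Real.log z + 2 + M) := by
  classical
  have hX1 : (1 : ℝ) ≤ X := by exact_mod_cast hX
  -- `D = B ∩ (B + d)` is itself sieved: it is large and occupies at most `T p` classes mod `p`.
  set D := B.filter fun b => b - d ∈ B with hD
  have hDc : (D.card : ℝ) = diffCount B d := rfl
  have hD0 : (0 : ℝ) < D.card := by rw [hDc]; linarith
  have h1 := sum_log_mul_collisions_le (B := D) hX1
    (abs_sub_le_of_subset_Icc ((Finset.filter_subset _ _).trans hB))
    (P := oddPrimesUpTo z) fun p hp => oddPrimesUpTo_prime hp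
  have h2 := sum_log_oddPrimesUpTo_le (y := z) (by linarith)
  set T : ℕ → ℝ := fun p => (((S p).filter fun x => x - (d : ZMod p) ∈ S p).card : ℝ) with hT
  have hTD : ∀ p ∈ oddPrimesUpTo z, 0 < T p ∧ T p ≤ ((p : ℝ) + 1) / 2 ∧
      (1 / T p) * (D.card : ℝ) ^ 2 ≤ collisions D p := by
    intro p hp
    have : NeZero p := ⟨(oddPrimesUpTo_prime hp).ne_zero⟩
    have h3 : ∀ b ∈ D, (b : ZMod p) ∈ (S p).filter fun x => x - (d : ZMod p) ∈ S p := by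
      intro b hb
      have hb' := Finset.mem_filter.1 hb
      refine Finset.mem_filter.2 ⟨hBS p hp b hb'.1, ?_⟩
      have := hBS p hp _ hb'.2
      rwa [Int.cast_sub] at this
    have h4 := sq_card_le_card_mul_collisions h3
    have h5 : 0 < T p := by
      have : D.Nonempty := Finset.card_pos.1 (by exact_mod_cast hD0)
      obtain ⟨b, hb⟩ := this
      exact Nat.cast_pos.2 (Finset.card_pos.2 ⟨_, h3 b hb⟩)
    refine ⟨h5, ?_, ?_⟩
    · rw [← hS p hp]
      exact Nat.cast_le.2 (Finset.card_filter_le _ _)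
    · rw [one_div_mul_eq_div, div_le_iff₀ h5, mul_comm]
      exact h4
  have h3 : ∑ p ∈ oddPrimesUpTo z, Real.log p * (1 / T p) ≤ Real.log X + 2 := by
    have e1 : (D.card : ℝ) ^ 2 * ∑ p ∈ oddPrimesUpTo z, Real.log p * (1 / T p) ≤
        (D.card : ℝ) ^ 2 * (Real.log X + 2) := by
      calc (D.card : ℝ) ^ 2 * ∑ p ∈ oddPrimesUpTo z, Real.log p * (1 / T p) =
            ∑ p ∈ oddPrimesUpTo z, Real.log p * (1 / T p * (D.card : ℝ) ^ 2) := by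
            rw [Finset.mul_sum]
            exact Finset.sum_congr rfl fun p _ => by ring
        _ ≤ ∑ p ∈ oddPrimesUpTo z, Real.log p * collisions D p :=
            Finset.sum_le_sum fun p hp =>
              mul_le_mul_of_nonneg_left (hTD p hp).2.2 (Real.log_natCast_nonneg p)
        _ ≤ (D.card : ℝ) ^ 2 * Real.log X + D.card * ∑ p ∈ oddPrimesUpTo z, Real.log p := h1
        _ ≤ (D.card : ℝ) ^ 2 * Real.log X + D.card * (2 * D.card) := by
            gcongr
            rw [hDc]
            linarith
        _ = _ := by ring
    exact le_of_mul_le_mul_left e1 (by positivity)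
  have h4 : ∑ p ∈ oddPrimesUpTo z, Real.log p * (2 / ((p : ℝ) + 1)) +
      2 / 31 * ∑ p ∈ (oddPrimesUpTo z).filter (fun p : ℕ => ¬ (p : ℝ) * (1 / 2 - 1 / 64) ≤ T p),
        Real.log p / p ≤ ∑ p ∈ oddPrimesUpTo z, Real.log p * (1 / T p) := by
    rw [Finset.sum_filter, Finset.mul_sum, ← Finset.sum_add_distrib]
    refine Finset.sum_le_sum fun p hp => ?_
    have hp0 : (0 : ℝ) < p := by exact_mod_cast (oddPrimesUpTo_prime hp).pos
    obtain ⟨e1, e2, -⟩ := hTD p hp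
    have hl := Real.log_natCast_nonneg p
    split_ifs with h
    · rw [mul_zero, add_zero]
      refine mul_le_mul_of_nonneg_left ?_ hl
      rw [← one_div_div]
      exact one_div_le_one_div_of_le e1 e2
    · have : 2 / ((p : ℝ) + 1) + 2 / 31 * (1 / p) ≤ 1 / T p := by
        have h5 : 1 / ((p : ℝ) * (1 / 2 - 1 / 64)) ≤ 1 / T p :=
          one_div_le_one_div_of_le e1 (not_le.1 h).le
        -- Each prime where the overlap falls below `31p/64` costs an extra `(2/31)/p`, whence the
        -- factor `31/2`.
        have h6 : 1 / ((p : ℝ) * (1 / 2 - 1 / 64)) = 2 / p + 2 / 31 * (1 / p) := by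
          field_simp
          norm_num
        have h7 : 2 / ((p : ℝ) + 1) ≤ 2 / p := by gcongr; linarith
        linarith
      calc _ = Real.log p * (2 / ((p : ℝ) + 1) + 2 / 31 * (1 / p)) := by ring
        _ ≤ _ := by gcongr
  have h5 := hM z hz
  linarith

open Filter in
set_option maxHeartbeats 1000000 in
/-- A set occupying half of the residues mod each odd prime cannot have size close to the extremal
one and simultaneously additive energy close to the maximal one. -/
theorem exists_sum_sq_diffCount_lt :
    ∃ ε : ℝ, 0 < ε ∧ ε ≤ 1 ∧ ∀ᶠ X : ℕ in atTop,
      ∀ (S : (p : ℕ) → Finset (ZMod p)) (B : Finset ℤ), B ⊆ Finset.Icc 1 (X : ℤ) →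
      (∀ p : ℕ, p.Prime → p ≠ 2 → (p : ℝ) ≤ (X : ℝ) ^ (1 / 2 : ℝ) →
        ((S p).card : ℝ) = ((p : ℝ) + 1) / 2) →
      (∀ p : ℕ, p.Prime → p ≠ 2 → (p : ℝ) ≤ (X : ℝ) ^ (1 / 2 : ℝ) →
        ∀ b ∈ B, (b : ZMod p) ∈ S p) →
      (X : ℝ) ^ (1 / 2 - ε : ℝ) ≤ B.card →
      ∑ n ∈ Finset.Icc (-(X : ℤ)) X, (diffCount B n : ℝ) ^ 2 <
        (B.card : ℝ) ^ 3 * (X : ℝ) ^ (-ε) := by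
  classical
  obtain ⟨M, hM0, hM⟩ := exists_mertens_oddPrimes
  obtain ⟨ε, hε⟩ : ∃ ε : ℝ, ε = 1 / 4000 := ⟨_, rfl⟩
  have hε0 : 0 < ε := by rw [hε]; norm_num
  refine ⟨ε, hε0, by rw [hε]; norm_num, ?_⟩
  have hlogtop : Tendsto (fun X : ℕ => Real.log X) atTop atTop :=
    Real.tendsto_log_atTop.comp tendsto_natCast_atTop_atTop
  have hpowtop : Tendsto (fun X : ℕ => (X : ℝ) ^ ε) atTop atTop :=
    (tendsto_rpow_atTop hε0).comp tendsto_natCast_atTop_atTop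
  filter_upwards [eventually_ge_atTop 9, hlogtop.eventually_ge_atTop (400 * (M + 10)),
    hpowtop.eventually_ge_atTop 2] with X hX9 hXL hX2 S B hB hS hBS hcard
  by_contra! hE
  have hX9' : (9 : ℝ) ≤ X := by exact_mod_cast hX9
  have hX0 : (0 : ℝ) < X := by linarith
  set L := Real.log X with hL
  set N : ℝ := (B.card : ℝ) with hN
  set z : ℝ := (X : ℝ) ^ (1 / 2 - 3 * ε : ℝ) with hz
  have hz1 : 1 ≤ z := Real.one_le_rpow (by linarith) (by rw [hε]; norm_num)
  have hz0 : 0 ≤ z := by linarith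
  have hzs : z ≤ (X : ℝ) ^ (1 / 2 : ℝ) :=
    Real.rpow_le_rpow_of_exponent_le (by linarith) (by linarith)
  have hlz : Real.log z = (1 / 2 - 3 * ε) * L := Real.log_rpow hX0 _
  have hN0 : 0 < N := lt_of_lt_of_le (by positivity) hcard
  have hmem : ∀ p ∈ oddPrimesUpTo z, p.Prime ∧ p ≠ 2 ∧ (p : ℝ) ≤ (X : ℝ) ^ (1 / 2 : ℝ) := by
    intro p hp
    obtain ⟨h1, h2, h3⟩ := (mem_oddPrimesUpTo hz0).1 hp
    exact ⟨h2, h1, h3.trans hzs⟩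
  -- Of the `3ε` in `z`, one `ε` is for the size of `B`, one for the popularity threshold, and one
  -- absorbs the factor `2`.
  have hzN : z ≤ (X : ℝ) ^ (-ε) * N / 2 := by
    have h1 : z * (X : ℝ) ^ ε = (X : ℝ) ^ (-ε) * (X : ℝ) ^ (1 / 2 - ε : ℝ) := by
      rw [hz, ← Real.rpow_add hX0, ← Real.rpow_add hX0]
      congr 1
      ring
    have h2 : (X : ℝ) ^ (-ε) * (X : ℝ) ^ (1 / 2 - ε : ℝ) ≤ (X : ℝ) ^ (-ε) * N := by gcongr
    nlinarith
  -- the popular differences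
  set D := (Finset.Icc (-(X : ℤ)) X).filter
    fun n => (X : ℝ) ^ (-ε) * N / 2 ≤ (diffCount B n : ℝ) with hD
  have hDz : z ≤ D.card := by
    refine hzN.trans (card_filter_ge_of_sum_sq_ge hN0 (by positivity) (fun _ _ => by positivity)
      (fun i _ => ?_) ?_ hE)
    · exact Nat.cast_le.2 (Finset.card_filter_le _ _)
    · have := sum_diffCount_mul (R := ℝ) hB fun _ => 1
      simp only [mul_one, Finset.sum_const, nsmul_eq_mul] at this
      rw [this, sq]
  have hD0 : (0 : ℝ) < D.card := by linarith
  set Q : ℕ → ℤ → Prop := fun p d =>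
    (p : ℝ) * (1 / 2 - 1 / 64) ≤ (((S p).filter fun x => x - (d : ZMod p) ∈ S p).card : ℝ) with hQ
  set g : ℕ → ℝ := fun p => ((D.filter fun d => Q p d).card : ℝ) with hg
  set W := 31 / 2 * (L - 2 * Real.log z + 2 + M) with hW
  have h1 : ∑ p ∈ oddPrimesUpTo z, Real.log p / p * (D.card - g p) ≤ D.card * W := by
    have e1 : ∀ p, (D.card : ℝ) - g p = ∑ d ∈ D, if ¬ Q p d then (1 : ℝ) else 0 := by
      intro p
      rw [Finset.sum_boole]
      have := Finset.card_filter_add_card_filter_not (s := D) (fun d => Q p d)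
      rw [hg, ← this]
      push_cast
      ring
    calc ∑ p ∈ oddPrimesUpTo z, Real.log p / p * (D.card - g p)
        = ∑ d ∈ D, ∑ p ∈ (oddPrimesUpTo z).filter (fun p => ¬ Q p d), Real.log p / p := by
          simp_rw [e1, Finset.mul_sum, Finset.sum_filter]
          rw [Finset.sum_comm]
          simp
      _ ≤ ∑ d ∈ D, W := by
          refine Finset.sum_le_sum fun d hd => ?_
          exact sum_log_div_not_almostPeriod_le (fun y hy => (hM y hy).2) (by omega) hB hz1
            (fun p hp => hS p (hmem p hp).1 (hmem p hp).2.1 (hmem p hp).2.2)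
            (fun p hp => hBS p (hmem p hp).1 (hmem p hp).2.1 (hmem p hp).2.2)
            (hzN.trans (Finset.mem_filter.1 hd).2)
      _ = _ := by simp
  set P := (oddPrimesUpTo z).filter fun p => 200 ≤ p with hP
  have hPsub : P ⊆ oddPrimesUpTo z := Finset.filter_subset _ _
  have h2 : ∀ p ∈ P, 7 / (p : ℝ) * (2 * g p * D.card - (D.card : ℝ) ^ 2) ≤ collisions D p := by
    intro p hp
    have hp' := Finset.mem_filter.1 hp
    have hpm := hmem p hp'.1
    have : NeZero p := ⟨hpm.1.ne_zero⟩
    have hp0 : (0 : ℝ) < p := by exact_mod_cast hpm.1.pos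
    have e1 := sq_card_filter_le_card_mul_collisions D p
      (almostPeriods (S p) ((p : ℝ) * (1 / 2 - 1 / 64)))
    have e2 : (D.filter fun d : ℤ => (d : ZMod p) ∈
        almostPeriods (S p) ((p : ℝ) * (1 / 2 - 1 / 64))) = D.filter fun d => Q p d :=
      Finset.filter_congr fun d _ => mem_almostPeriods
    rw [e2] at e1
    have e3 := card_almostPeriods_le hpm.1 hp'.2 (hS p hpm.1 hpm.2.1 hpm.2.2)
    have e4 : g p ^ 2 ≤ p / 7 * collisions D p := e1.trans (by gcongr)
    -- Linearising the square allows the average over `d` in `h1` to be used.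
    have e5 : 2 * g p * D.card - (D.card : ℝ) ^ 2 ≤ g p ^ 2 := by
      nlinarith [sq_nonneg (g p - D.card)]
    calc 7 / (p : ℝ) * (2 * g p * D.card - (D.card : ℝ) ^ 2)
        ≤ 7 / (p : ℝ) * (p / 7 * collisions D p) := by gcongr; exact e5.trans e4
      _ = _ := by field_simp
  have h3 : ∑ p ∈ P, Real.log p * collisions D p ≤ (D.card : ℝ) ^ 2 * (L + 3) := by
    have hDX : ∀ b ∈ D, ∀ b' ∈ D, |(b : ℝ) - b'| ≤ 2 * X := by
      intro b hb b' hb'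
      have e1 := Finset.mem_Icc.1 (Finset.mem_filter.1 hb).1
      have e2 := Finset.mem_Icc.1 (Finset.mem_filter.1 hb').1
      have : |b - b'| ≤ 2 * (X : ℤ) := by rw [abs_le]; omega
      exact_mod_cast this
    have e1 := sum_log_mul_collisions_le (by linarith) hDX (P := P)
      fun p hp => oddPrimesUpTo_prime (hPsub hp)
    have e2 : ∑ p ∈ P, Real.log p ≤ 2 * D.card := by
      refine le_trans (Finset.sum_le_sum_of_subset_of_nonneg hPsub
        fun p _ _ => Real.log_natCast_nonneg p) ((sum_log_oddPrimesUpTo_le hz0).trans ?_)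
      linarith
    have e3 : Real.log (2 * X) ≤ 1 + L := by
      rw [Real.log_mul (by norm_num) hX0.ne']
      linarith [Real.log_two_lt_d9]
    calc _ ≤ (D.card : ℝ) ^ 2 * (1 + L) + D.card * (2 * D.card) := e1.trans (by gcongr)
      _ = _ := by ring
  have h4 : 7 * ∑ p ∈ P, Real.log p / p * (2 * g p * D.card - (D.card : ℝ) ^ 2) ≤
      ∑ p ∈ P, Real.log p * collisions D p := by
    rw [Finset.mul_sum]
    refine Finset.sum_le_sum fun p hp => ?_
    calc 7 * (Real.log p / p * (2 * g p * D.card - (D.card : ℝ) ^ 2)) =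
        Real.log p * (7 / (p : ℝ) * (2 * g p * D.card - (D.card : ℝ) ^ 2)) := by ring
      _ ≤ _ := mul_le_mul_of_nonneg_left (h2 p hp) (Real.log_natCast_nonneg p)
  have h5 : ∑ p ∈ P, Real.log p / p * (2 * g p * D.card - (D.card : ℝ) ^ 2) =
      (D.card : ℝ) ^ 2 * ∑ p ∈ P, Real.log p / p -
        2 * D.card * ∑ p ∈ P, Real.log p / p * (D.card - g p) := by
    rw [Finset.mul_sum, Finset.mul_sum, ← Finset.sum_sub_distrib]
    exact Finset.sum_congr rfl fun p _ => by ring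
  have h6 : ∑ p ∈ P, Real.log p / p * (D.card - g p) ≤ D.card * W := by
    refine le_trans (Finset.sum_le_sum_of_subset_of_nonneg hPsub fun p _ _ => ?_) h1
    refine mul_nonneg (div_nonneg (Real.log_natCast_nonneg p) (Nat.cast_nonneg p)) ?_
    rw [sub_nonneg]
    exact Nat.cast_le.2 (Finset.card_filter_le _ _)
  have h7 : Real.log z - 2 * M - 8 ≤ ∑ p ∈ P, Real.log p / p := by
    have e1 := Finset.sum_filter_add_sum_filter_not (oddPrimesUpTo z) (fun p => 200 ≤ p)
      (fun p => Real.log p / (p : ℝ))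
    have e2 : ∑ p ∈ (oddPrimesUpTo z).filter (fun p => ¬ 200 ≤ p), Real.log p / p ≤
        ∑ p ∈ oddPrimesUpTo 200, Real.log p / p := by
      refine Finset.sum_le_sum_of_subset_of_nonneg (fun p hp => ?_)
        fun p _ _ => div_nonneg (Real.log_natCast_nonneg p) (Nat.cast_nonneg p)
      obtain ⟨a, b⟩ := Finset.mem_filter.1 hp
      obtain ⟨a1, a2, -⟩ := (mem_oddPrimesUpTo hz0).1 a
      refine (mem_oddPrimesUpTo (by norm_num)).2 ⟨a1, a2, ?_⟩
      exact_mod_cast (not_le.1 b).le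
    have e3 := (abs_le.1 (hM z hz1).1).1
    have e4 := (abs_le.1 (hM 200 (by norm_num)).1).2
    have e5 : Real.log 200 ≤ 8 := by
      calc Real.log 200 ≤ Real.log (2 ^ 8) := Real.log_le_log (by norm_num) (by norm_num)
        _ = 8 * Real.log 2 := by rw [Real.log_pow]; norm_num
        _ ≤ 8 := by linarith [Real.log_two_lt_d9]
    rw [← hP] at e1
    linarith
  have h8 : (D.card : ℝ) ^ 2 * (7 * (Real.log z - 2 * M - 8) - 14 * W) ≤
      (D.card : ℝ) ^ 2 * (L + 3) := by
    have e1 := mul_le_mul_of_nonneg_left h7 (sq_nonneg (D.card : ℝ))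
    have e2 := mul_le_mul_of_nonneg_left h6 (by positivity : (0 : ℝ) ≤ 2 * D.card)
    rw [h5] at h4
    have := h4.trans h3
    nlinarith
  -- The left side is about `(7/2) log X`, less `O(ε) log X` and constants, which exceeds `log X +
  -- 3`.
  have h9 := le_of_mul_le_mul_left h8 (by positivity)
  rw [hW, hlz, hε] at h9
  linarith

-- Conclusion.

/- `(S p).addEnergy (S p)` is the number of additive quadruples of `S p`, that is, of quadruples
of elements of `S p` with `s₁ + s₂ = s₃ + s₄`. The constants `c` and `C` are absolute. -/
theorem theorem1p1 :
    ∃ c : ℝ, 0 < c ∧ ∃ C : ℝ, 0 < C ∧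
      ∀ (X : ℕ) (_ : 9 ≤ X) (δ : ℝ) (_ : 0 < δ)
        (S : (p : ℕ) → Finset (ZMod p)) (A : Set ℤ),
        (∀ p : ℕ, p.Prime → p ≠ 2 → (p : ℝ) ≤ (X : ℝ) ^ (1 / 2 : ℝ) →
          ((S p).card : ℝ) = ((p : ℝ) + 1) / 2) →
        (∀ p : ℕ, p.Prime → p ≠ 2 → (p : ℝ) ≤ (X : ℝ) ^ (1 / 2 : ℝ) →
          (1 / 16 + δ) * (p : ℝ) ^ 3 ≤ ((S p).addEnergy (S p) : ℝ)) →
        (∀ p : ℕ, p.Prime → p ≠ 2 → (p : ℝ) ≤ (X : ℝ) ^ (1 / 2 : ℝ) →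
          ∀ a ∈ A, (a : ZMod p) ∈ S p) →
        ((initialPart A X).ncard : ℝ) ≤ C * (X : ℝ) ^ (1 / 2 - c * δ ^ 2 : ℝ) := by
  obtain ⟨ε, hε0, hε1, hupper⟩ := exists_sum_sq_diffCount_lt
  obtain ⟨c, hc0, hcε, K, hK0, hlower⟩ := exists_sum_sq_diffCount_ge hε0 hε1
  obtain ⟨C₀, hC₀, htriv⟩ := exists_card_le_mul_sqrt
  obtain ⟨X₀, hX₀⟩ := Filter.eventually_atTop.1 (hupper.and hlower)
  have hc1 : 0 < min c (1 / 2) := by positivity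
  -- The three summands of `C` serve bounded `δ log X`, small `X` and the main case. The cap `1/2`
  -- keeps the exponent nonnegative, so that `X₀` covers small `X`.
  refine ⟨min c (1 / 2), hc1, C₀ * Real.exp (min c (1 / 2) * K) + X₀ + 1, by positivity, ?_⟩
  intro X hX9 δ hδ0 S A hS hE hA
  set c' := min c (1 / 2) with hc'
  have hX9' : (9 : ℝ) ≤ X := by exact_mod_cast hX9
  have hX0 : (0 : ℝ) < X := by linarith
  have hL0 : 0 ≤ Real.log X := Real.log_nonneg (by linarith)
  -- The prime `3` is available because `X ≥ 9`: `|S 3| = 2` allows at most `16` quadruples, while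
  -- the hypothesis demands `27(1/16 + δ)`. Then `δ² ≤ δ`, so an exponent saving of `cδ` is enough.
  have hδ1 : δ ≤ 1 := by
    have h3 : ((3 : ℕ) : ℝ) ≤ (X : ℝ) ^ (1 / 2 : ℝ) := by
      calc ((3 : ℕ) : ℝ) = (9 : ℝ) ^ (1 / 2 : ℝ) := by
            rw [show (9 : ℝ) = 3 ^ (2 : ℝ) by norm_num, ← Real.rpow_mul (by norm_num)]
            norm_num
        _ ≤ _ := Real.rpow_le_rpow (by norm_num) hX9' (by norm_num)
    have h4 := hE 3 Nat.prime_three (by norm_num) h3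
    have h5 := hS 3 Nat.prime_three (by norm_num) h3
    have h6 : (S 3).card = 2 := by
      have : ((S 3).card : ℝ) = 2 := by rw [h5]; norm_num
      exact_mod_cast this
    have h7 : ((S 3).addEnergy (S 3) : ℝ) ≤ 16 := by
      have : (S 3).addEnergy (S 3) ≤ 16 := by
        refine (Finset.card_filter_le _ _).trans ?_
        simp [Finset.card_product, h6]
      exact_mod_cast this
    push_cast at h4
    linarith
  have hsq : δ ^ 2 ≤ δ := by nlinarith
  have hfin : (initialPart A X).Finite := (Set.finite_Icc (1 : ℤ) X).subset Set.inter_subset_right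
  set B := hfin.toFinset with hBdef
  rw [Set.ncard_eq_toFinset_card _ hfin]
  have hB : B ⊆ Finset.Icc 1 (X : ℤ) := fun b hb => by
    rw [hBdef, Set.Finite.mem_toFinset] at hb
    exact Finset.mem_Icc.2 hb.2
  have hBS : ∀ p : ℕ, p.Prime → p ≠ 2 → (p : ℝ) ≤ (X : ℝ) ^ (1 / 2 : ℝ) →
      ∀ b ∈ B, (b : ZMod p) ∈ S p := fun p h1 h2 h3 b hb => by
    rw [hBdef, Set.Finite.mem_toFinset] at hb
    exact hA p h1 h2 h3 b hb.1
  have hpow0 : 0 ≤ (X : ℝ) ^ (1 / 2 - c' * δ ^ 2 : ℝ) := by positivity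
  have hmono : ∀ a : ℝ, 0 ≤ a → a ≤ C₀ * Real.exp (c' * K) + X₀ + 1 →
      (B.card : ℝ) ≤ a * (X : ℝ) ^ (1 / 2 - c' * δ ^ 2 : ℝ) →
      (B.card : ℝ) ≤ (C₀ * Real.exp (c' * K) + X₀ + 1) * (X : ℝ) ^ (1 / 2 - c' * δ ^ 2 : ℝ) :=
    fun a _ h1 h2 => h2.trans (mul_le_mul_of_nonneg_right h1 hpow0)
  have hexp0 : 0 < C₀ * Real.exp (c' * K) := by positivity
  have hX₀0 : (0 : ℝ) ≤ X₀ := Nat.cast_nonneg _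
  rcases lt_or_ge X X₀ with hlt | hge
  · have hle : (X : ℝ) ≤ X₀ := by exact_mod_cast hlt.le
    refine hmono X₀ hX₀0 (by linarith) ?_
    have h1 : (B.card : ℝ) ≤ X := by
      have := Finset.card_le_card hB
      rw [Int.card_Icc] at this
      have h2 : B.card ≤ X := by omega
      exact_mod_cast h2
    have h2 : 1 ≤ (X : ℝ) ^ (1 / 2 - c' * δ ^ 2 : ℝ) := by
      refine Real.one_le_rpow (by linarith) ?_
      have : c' ≤ 1 / 2 := min_le_right _ _
      nlinarith
    nlinarith
  rcases lt_or_ge (δ * Real.log X) K with hlt | hgeK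
  · refine hmono (C₀ * Real.exp (c' * K)) hexp0.le (by linarith) ?_
    refine (htriv X S B (by omega) hB hS hBS).trans ?_
    rw [mul_assoc]
    refine mul_le_mul_of_nonneg_left ?_ hC₀.le
    rw [Real.rpow_def_of_pos hX0, Real.rpow_def_of_pos hX0, ← Real.exp_add, Real.exp_le_exp]
    have h1 : δ ^ 2 * Real.log X ≤ K := (mul_le_mul_of_nonneg_right hsq hL0).trans hlt.le
    have h2 := mul_le_mul_of_nonneg_left h1 hc1.le
    linarith
  · refine hmono 1 zero_le_one (by linarith) ?_
    rw [one_mul]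
    by_contra! hcon
    obtain ⟨hup, hlo⟩ := hX₀ X hge
    have hcc : c' ≤ c := min_le_left _ _
    have h1 : (X : ℝ) ^ (1 / 2 - c * δ : ℝ) ≤ B.card := by
      refine le_trans (Real.rpow_le_rpow_of_exponent_le (by linarith) ?_) hcon.le
      nlinarith
    have h2 : (X : ℝ) ^ (1 / 2 - ε : ℝ) ≤ B.card := by
      refine le_trans (Real.rpow_le_rpow_of_exponent_le (by linarith) ?_) h1
      nlinarith
    exact absurd (hlo δ S B hδ0 hδ1 hgeK hB hS hE hBS h1) (not_le.2 (hup S B hB hS hBS h2))
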